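/- Let $d\in\mathbb{N}$, let $\mu,\mu_{\min}\in\mathbb{R}^d$, and let $\Sigma\in\mathbb{R}^{d\times d}$ be symmetric positive definite. Training (majority) pairs $(x,y)$ satisfy $\mathbb{P}[y=1]=\mathbb{P}[y=-1]=\tfrac12$ and $x\mid y\sim\mathcal{N}(y\mu,\Sigma)$; test (minority) pairs satisfy $\mathbb{P}[y=1]=\mathbb{P}[y=-1]=\tfrac12$ and $x\mid y\sim\mathcal{N}(y\mu_{\min},I)$. Let $\mathcal{D}_n=\{(x_i,y_i)\}_{i=0}^n$ be i.i.d. training pairs. For a matrix $R\in\mathbb{R}^{d\times d}$, let $\hat y^{(n)}_R(x)$ be the label $y_i$ of the sample point for which $\|Rx_i-Rx\|_2$ is smallest (ties go to the smallest index), i.e. the 1-nearest-neighbour label in the representation $x\mapsto Rx$. We say that $L\in\mathbb{R}$ is the asymptotic 1-NN labelling error for $R$ if, for an independent test pair $(x,y)$ and as $n\to\infty$, $\mathbb{P}[\hat y^{(n)}_R(x)\neq y\mid\mathcal{D}_n]\to L$ in probability and $\mathbb{P}[\hat y^{(n)}_R(x)\neq y]\to L$. Assume that $\mu_{\min}^\top\Sigma^{-1}\mu<0$.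 Then $\mu\neq\mu_{\min}$, and for the orthogonal projection $P\in\mathbb{R}^{d\times d}$ onto the hyperplane orthogonal to $w=\tfrac12(\mu-\mu_{\min})$, the asymptotic 1-NN labelling errors $\mathrm{err}^{\mathrm{rep}}_{\mathrm{1NN}}$ (for $R=P$) and $\mathrm{err}^{\mathrm{raw}}_{\mathrm{1NN}}$ (for $R=I$) both exist, and $$\mathrm{err}^{\mathrm{rep}}_{\mathrm{1NN}}<\mathrm{err}^{\mathrm{raw}}_{\mathrm{1NN}}.$$ -/

import Mathlib

open MeasureTheory ProbabilityTheory Filter Topology Matrix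
open scoped ENNReal

/-- The law of a labelled point `(x, y)` in `ℝᵈ × {-1, 1}` with balanced labels,
`P[y = 1] = P[y = -1] = 1/2`, and class conditionals `x ∣ y ∼ N(y m, S)`. -/
noncomputable def balancedGaussianPair {d : ℕ} (m : EuclideanSpace ℝ (Fin d))
    (S : Matrix (Fin d) (Fin d) ℝ) : Measure (EuclideanSpace ℝ (Fin d) × ℤ) :=
  (1 / 2 : ℝ≥0∞) • (multivariateGaussian m S).map (fun x => (x, (1 : ℤ))) +
    (1 / 2 : ℝ≥0∞) • (multivariateGaussian (-m) S).map (fun x => (x, (-1 : ℤ)))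

/-- A labelled sample `(x₀, y₀), …, (xₙ, yₙ)`. -/
abbrev LabelledSample (d n : ℕ) : Type :=
  Fin (n + 1) → EuclideanSpace ℝ (Fin d) × ℤ

/-- The law of `n + 1` independent labelled points, each distributed as
`balancedGaussianPair m S`. -/
noncomputable def sampleLaw {d : ℕ} (m : EuclideanSpace ℝ (Fin d))
    (S : Matrix (Fin d) (Fin d) ℝ) (n : ℕ) : Measure (LabelledSample d n) :=
  Measure.pi fun _ => balancedGaussianPair m S

section NearestNeighbour

variable {d n : ℕ}

open Classical in
/-- The indices of the sample points nearest to `x` in Euclidean distance, both the sample and `x`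
being seen through the representation `R`. -/
noncomputable def nearestIndices (R : Matrix (Fin d) (Fin d) ℝ) (D : LabelledSample d n)
    (x : EuclideanSpace ℝ (Fin d)) : Finset (Fin (n + 1)) :=
  Finset.univ.filter fun i => ∀ j,
    dist (toEuclideanCLM (𝕜 := ℝ) R (D i).1) (toEuclideanCLM (𝕜 := ℝ) R x) ≤
      dist (toEuclideanCLM (𝕜 := ℝ) R (D j).1) (toEuclideanCLM (𝕜 := ℝ) R x)

lemma nearestIndices_nonempty (R : Matrix (Fin d) (Fin d) ℝ) (D : LabelledSample d n)
    (x : EuclideanSpace ℝ (Fin d)) : (nearestIndices R D x).Nonempty := by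
  obtain ⟨i, -, hi⟩ := Finset.exists_min_image (Finset.univ : Finset (Fin (n + 1)))
    (fun i => dist (toEuclideanCLM (𝕜 := ℝ) R (D i).1) (toEuclideanCLM (𝕜 := ℝ) R x))
    Finset.univ_nonempty
  exact ⟨i, by simpa [nearestIndices] using fun j => hi j (Finset.mem_univ j)⟩

/-- The label that the 1-nearest-neighbour rule with training sample `D` and representation `R`
gives to `x`: the label of the nearest sample point, ties going to the smallest index. -/
noncomputable def oneNNLabel (R : Matrix (Fin d) (Fin d) ℝ) (D : LabelledSample d n)
    (x : EuclideanSpace ℝ (Fin d)) : ℤ :=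
  (D ((nearestIndices R D x).min' (nearestIndices_nonempty R D x))).2

/-- The labelling error of the 1-nearest-neighbour rule for a given training sample `D`: the
probability, over a test pair `(x, y)` with balanced label `y` and `x ∣ y ∼ N(y m, S)`,
that the rule does not return `y`. -/
noncomputable def oneNNError (R : Matrix (Fin d) (Fin d) ℝ) (m : EuclideanSpace ℝ (Fin d))
    (S : Matrix (Fin d) (Fin d) ℝ) (D : LabelledSample d n) : ℝ :=
  (balancedGaussianPair m S).real {p | oneNNLabel R D p.1 ≠ p.2}

end NearestNeighbour

/-- `L` is the asymptotic labelling error of the 1-nearest-neighbour rule on the representation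
`R`, with training pairs `x ∣ y ∼ N(y μ, S)` and test pairs `x ∣ y ∼ N(y m, T)`, labels balanced:
as the sample size tends to infinity, the labelling error given the training sample
converges to `L` in probability, and the labelling error over the joint draw of the training
sample and the test pair converges to `L`. -/
def IsAsymptoticOneNNError {d : ℕ} (R : Matrix (Fin d) (Fin d) ℝ)
    (μ : EuclideanSpace ℝ (Fin d)) (S : Matrix (Fin d) (Fin d) ℝ)
    (m : EuclideanSpace ℝ (Fin d)) (T : Matrix (Fin d) (Fin d) ℝ) (L : ℝ) : Prop :=
  (∀ ε : ℝ, 0 < ε →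
    Tendsto (fun n : ℕ => (sampleLaw μ S n) {D | ε ≤ |oneNNError R m T D - L|}) atTop (𝓝 0)) ∧
  Tendsto (fun n : ℕ => ((sampleLaw μ S n).prod (balancedGaussianPair m T)).real
    {q | oneNNLabel R q.1 q.2.1 ≠ q.2.2}) atTop (𝓝 L)

/-! Put `φ = R`, symmetric. If `u` solves `φ S φ u = φ μ`, the training label given `z = φ x` has a
logistic posterior with log-odds `2⟪u, z⟫`: the two class laws of `z` differ by a Cameron-Martin
density (`multivariateGaussian_map_eq_withDensity`), with no normalising constant because the means
are opposite. The nearest neighbour of a test point converges to it, so its label is in the limit a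
draw from that posterior (`IsPosterior.tendsto_nnLabel`). For two distinct test points these draws
become independent (`IsPosterior.tendsto_nnLabel_mul`), so the conditional error has vanishing
variance and converges in probability (`IsPosterior.tendsto_nnLabel_error`).

The limit error is therefore `1 - E[sigmoid (2 s)]` with `s` a real Gaussian of mean `⟪φ u, μmin⟫`,
and its position relative to `1/2` is decided by the sign of that mean, whatever the variance. For
`R = 1`, `u = S⁻¹ μ` and the mean is `μminᵀ S⁻¹ μ < 0`: the error exceeds `1/2`. For `R = P`, take
`u = S⁻¹ (μ - c w)` with `c` making `u ⟂ w`. Since `μmin = μ - 2 w = S u + (c - 2) w`, the mean is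
`uᵀ S u ≥ 0`: the error is at most `1/2`. Only `P = 0` escapes this argument; there the error is
exactly `1/2`. -/

/-! ### Nearest neighbours in a metric space and their measurability. -/

section NearestNeighbourIndex

variable {X : Type*} [MetricSpace X] {n : ℕ}

open Classical in
/-- The indices at which the points `z i` are nearest to `q`. -/
noncomputable def nearestSet (z : Fin (n + 1) → X) (q : X) : Finset (Fin (n + 1)) :=
  Finset.univ.filter fun i => ∀ j, dist (z i) q ≤ dist (z j) q

lemma mem_nearestSet {z : Fin (n + 1) → X} {q : X} {i : Fin (n + 1)} :
    i ∈ nearestSet z q ↔ ∀ j, dist (z i) q ≤ dist (z j) q := by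
  simp [nearestSet]

lemma nearestSet_nonempty (z : Fin (n + 1) → X) (q : X) : (nearestSet z q).Nonempty := by
  obtain ⟨i, -, hi⟩ := Finset.exists_min_image (Finset.univ : Finset (Fin (n + 1)))
    (fun i => dist (z i) q) Finset.univ_nonempty
  exact ⟨i, mem_nearestSet.2 fun j => hi j (Finset.mem_univ j)⟩

/-- The smallest index at which the points `z i` are nearest to `q`. -/
noncomputable def nnIndex (z : Fin (n + 1) → X) (q : X) : Fin (n + 1) :=
  (nearestSet z q).min' (nearestSet_nonempty z q)

lemma dist_nnIndex_le (z : Fin (n + 1) → X) (q : X) (j : Fin (n + 1)) :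
    dist (z (nnIndex z q)) q ≤ dist (z j) q :=
  mem_nearestSet.1 ((nearestSet z q).min'_mem (nearestSet_nonempty z q)) j

lemma nnIndex_eq_iff {z : Fin (n + 1) → X} {q : X} {i : Fin (n + 1)} :
    nnIndex z q = i ↔
      (∀ j, dist (z i) q ≤ dist (z j) q) ∧ ∀ k, k < i → ¬ ∀ j, dist (z k) q ≤ dist (z j) q := by
  simp_rw [← mem_nearestSet]
  constructor
  · rintro rfl
    exact ⟨Finset.min'_mem _ _, fun k hk hk' => not_lt.2 (Finset.min'_le _ _ hk') hk⟩
  · rintro ⟨h1, h2⟩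
    refine le_antisymm (Finset.min'_le _ _ h1) (not_lt.1 fun h => h2 _ h (Finset.min'_mem _ _))

attribute [irreducible] nnIndex

/-- The label of the sample point nearest to `q`, ties going to the smallest index. -/
noncomputable def nnLabel (D : Fin (n + 1) → X × ℤ) (q : X) : ℤ :=
  (D (nnIndex (fun i => (D i).1) q)).2

/-- The sample point nearest to `q`, ties going to the smallest index. -/
noncomputable def nnPoint (D : Fin (n + 1) → X × ℤ) (q : X) : X :=
  (D (nnIndex (fun i => (D i).1) q)).1

variable [SecondCountableTopology X] [MeasurableSpace X] [BorelSpace X]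

lemma measurable_nnIndex :
    Measurable fun p : (Fin (n + 1) → X) × X => nnIndex p.1 p.2 := by
  refine measurable_to_countable' fun i => ?_
  have key : ∀ k : Fin (n + 1), MeasurableSet
      {p : (Fin (n + 1) → X) × X | ∀ j, dist (p.1 k) p.2 ≤ dist (p.1 j) p.2} := fun k => by
    simp_rw [Set.ofPred_forall]
    exact MeasurableSet.iInter fun j => measurableSet_le (by fun_prop) (by fun_prop)
  have : (fun p : (Fin (n + 1) → X) × X => nnIndex p.1 p.2) ⁻¹' {i} =
      {p | ∀ j, dist (p.1 i) p.2 ≤ dist (p.1 j) p.2} ∩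
        ⋂ k : Fin (n + 1), ⋂ _ : k < i, {p | ∀ j, dist (p.1 k) p.2 ≤ dist (p.1 j) p.2}ᶜ := by
    ext p
    simp only [Set.mem_preimage, Set.mem_singleton_iff, nnIndex_eq_iff, Set.mem_inter_iff,
      Set.mem_ofPred_eq, Set.mem_iInter, Set.mem_compl_iff]
  rw [this]
  exact (key i).inter (MeasurableSet.iInter fun k => MeasurableSet.iInter fun _ => (key k).compl)

lemma measurable_sample_nnIndex :
    Measurable fun p : (Fin (n + 1) → X × ℤ) × X => nnIndex (fun i => (p.1 i).1) p.2 := by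
  have : Measurable fun p : (Fin (n + 1) → X × ℤ) × X =>
      ((fun i => (p.1 i).1 : Fin (n + 1) → X), p.2) := by
    fun_prop
  exact measurable_nnIndex.comp this

lemma measurable_nn :
    Measurable fun p : (Fin (n + 1) → X × ℤ) × X => p.1 (nnIndex (fun i => (p.1 i).1) p.2) := by
  have h : Measurable fun p : (Fin (n + 1) → X × ℤ) × Fin (n + 1) => p.1 p.2 :=
    measurable_from_prod_countable_left fun i => measurable_pi_apply i
  exact h.comp (measurable_fst.prodMk measurable_sample_nnIndex)

lemma measurable_nnLabel : Measurable fun p : (Fin (n + 1) → X × ℤ) × X => nnLabel p.1 p.2 :=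
  measurable_snd.comp measurable_nn

lemma measurable_nnPoint : Measurable fun p : (Fin (n + 1) → X × ℤ) × X => nnPoint p.1 p.2 :=
  measurable_fst.comp measurable_nn

end NearestNeighbourIndex

/-! ### Posterior label probabilities, and averaging out a neighbour's label. -/

section Posterior

variable {X : Type*} [MeasurableSpace X]

/-- `η a x` is a version of the conditional probability of the label `a` given the point `x`,
under the law `Q` of a labelled point. -/
structure IsPosterior (Q : Measure (X × ℤ)) (η : ℤ → X → ℝ≥0∞) : Prop where
  measurable : ∀ a, Measurable (η a)
  le_one : ∀ a x, η a x ≤ 1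
  lintegral_eq : ∀ (a : ℤ) (h : X → ℝ≥0∞), Measurable h →
    ∫⁻ p, h p.1 * (if p.2 = a then 1 else 0) ∂Q = ∫⁻ p, h p.1 * η a p.1 ∂Q

lemma IsPosterior.measurable_uncurry {Q : Measure (X × ℤ)} {η : ℤ → X → ℝ≥0∞}
    (hη : IsPosterior Q η) : Measurable fun p : X × ℤ => η p.2 p.1 :=
  measurable_from_prod_countable_left hη.measurable

lemma measurable_label_ite {Ω : Type*} [MeasurableSpace Ω] {f : Ω → ℤ} (hf : Measurable f)
    (a : ℤ) : Measurable fun ω => (if f ω = a then 1 else 0 : ℝ≥0∞) :=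
  Measurable.ite (hf (measurableSet_singleton a)) measurable_const measurable_const

/-- Averaging out the label of the sample point with a random index, against a weight that does
not depend on that label. -/
lemma IsPosterior.lintegral_pi {Q : Measure (X × ℤ)} [IsProbabilityMeasure Q]
    {η : ℤ → X → ℝ≥0∞} (hη : IsPosterior Q η) {n : ℕ}
    {I : (Fin (n + 1) → X) → Fin (n + 1)} (hI : Measurable I)
    {G : (Fin (n + 1) → X × ℤ) → ℝ≥0∞} (hG : Measurable G)
    (hGI : ∀ D i b, I (fun j => (D j).1) = i → G (Function.update D i ((D i).1, b)) = G D)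
    (a : ℤ) :
    ∫⁻ D, G D * (if (D (I fun j => (D j).1)).2 = a then 1 else 0) ∂Measure.pi (fun _ => Q) =
      ∫⁻ D, G D * η a (D (I fun j => (D j).1)).1 ∂Measure.pi (fun _ => Q) := by
  classical
  have hIm : Measurable fun D : Fin (n + 1) → X × ℤ => I fun j => (D j).1 :=
    hI.comp (by fun_prop)
  have hite : ∀ i, Measurable fun D : Fin (n + 1) → X × ℤ =>
      (if I (fun j => (D j).1) = i then 1 else 0 : ℝ≥0∞) := fun i =>
    Measurable.ite (hIm (measurableSet_singleton i)) measurable_const measurable_const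
  have hlab : ∀ i, Measurable fun D : Fin (n + 1) → X × ℤ =>
      (if (D i).2 = a then 1 else 0 : ℝ≥0∞) := fun i =>
    measurable_label_ite (measurable_snd.comp (measurable_pi_apply i)) a
  have hηm : ∀ i, Measurable fun D : Fin (n + 1) → X × ℤ => η a (D i).1 := fun i =>
    (hη.measurable a).comp (measurable_fst.comp (measurable_pi_apply i))
  -- Splitting by the value of the random index, which depends on the positions only, reduces the
  -- claim to a fixed index `i`; there it suffices to integrate out coordinate `i`.
  have split : ∀ (D : Fin (n + 1) → X × ℤ) (g : Fin (n + 1) → ℝ≥0∞),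
      G D * g (I fun j => (D j).1) =
        ∑ i, G D * (if I (fun j => (D j).1) = i then 1 else 0) * g i := by
    intro D g
    simp
  rw [lintegral_congr fun D => split D fun i => if (D i).2 = a then 1 else 0,
    lintegral_congr fun D => split D fun i => η a (D i).1,
    lintegral_finsetSum (f := fun i D => G D * (if I (fun j => (D j).1) = i then 1 else 0) *
      (if (D i).2 = a then 1 else 0)) _ fun i _ => (hG.mul (hite i)).mul (hlab i),
    lintegral_finsetSum (f := fun i D => G D * (if I (fun j => (D j).1) = i then 1 else 0) *
      η a (D i).1) _ fun i _ => (hG.mul (hite i)).mul (hηm i)]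
  refine Finset.sum_congr rfl fun i _ => ?_
  refine lintegral_eq_of_lmarginal_eq (μ := fun _ => Q) {i} ((hG.mul (hite i)).mul (hlab i))
    ((hG.mul (hite i)).mul (hηm i)) ?_
  ext D
  rw [lmarginal_singleton, lmarginal_singleton]
  set h : X → ℝ≥0∞ := fun x => G (Function.update D i (x, 0)) *
    (if I (fun j => (Function.update D i (x, 0) j).1) = i then 1 else 0) with hh
  have hupd : Measurable fun x : X => Function.update D i (x, (0 : ℤ)) :=
    (measurable_update D).comp (by fun_prop)
  have hhm : Measurable h := (hG.mul (hite i)).comp hupd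
  have hfst : ∀ (x : X) (b : ℤ), (fun j => (Function.update D i (x, b) j).1) =
      Function.update (fun j => (D j).1) i x := by
    intro x b
    ext j
    by_cases hj : j = i
    · subst hj; simp
    · simp [hj]
  have hval : ∀ p : X × ℤ, G (Function.update D i p) *
      (if I (fun j => (Function.update D i p j).1) = i then 1 else 0) = h p.1 := by
    rintro ⟨x, b⟩
    simp only [hh, hfst]
    split_ifs with hi
    · have := hGI (Function.update D i (x, 0)) i b (by rw [hfst]; exact hi)
      simp only [Function.update_self, Function.update_idem] at this
      rw [this]
    · simp
  simp only [hval, Function.update_self]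
  exact hη.lintegral_eq a h hhm

end Posterior

/-! ### Limiting law of the labels at one and at two query points. -/

section Limits

/-- Convergence of the integrals of functions with values in `[0, 1]` that are close to a constant
outside of sets of small probability. -/
lemma tendsto_lintegral_of_forall_bad {Ω : ℕ → Type*} [∀ n, MeasurableSpace (Ω n)]
    {P : ∀ n, Measure (Ω n)} [∀ n, IsProbabilityMeasure (P n)] {F : ∀ n, Ω n → ℝ≥0∞}
    (hF : ∀ n, Measurable (F n)) (hF1 : ∀ n ω, F n ω ≤ 1) {c : ℝ≥0∞} (hc : c ≤ 1)
    (h : ∀ ε : ℝ≥0∞, 0 < ε → ∃ B : ∀ n, Set (Ω n), (∀ n, MeasurableSet (B n)) ∧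
      Tendsto (fun n => P n (B n)) atTop (𝓝 0) ∧
      ∀ n, ∀ ω ∉ B n, F n ω ≤ c + ε ∧ c ≤ F n ω + ε) :
    Tendsto (fun n => ∫⁻ ω, F n ω ∂P n) atTop (𝓝 c) := by
  rw [ENNReal.tendsto_nhds (hc.trans_lt ENNReal.one_lt_top).ne]
  intro ε hε
  obtain ⟨B, hB, hB0, hbad⟩ := h (ε / 2) (ENNReal.half_pos hε.ne')
  filter_upwards [ENNReal.tendsto_nhds_zero.1 hB0 (ε / 2) (ENNReal.half_pos hε.ne')] with n hn
  have hind : ∫⁻ ω, (B n).indicator 1 ω ∂P n ≤ ε / 2 := by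
    rwa [lintegral_indicator_one (hB n)]
  have hindm : Measurable ((B n).indicator (1 : Ω n → ℝ≥0∞)) := measurable_one.indicator (hB n)
  constructor
  · rw [tsub_le_iff_right]
    calc c = ∫⁻ _, c ∂P n := by simp
      _ ≤ ∫⁻ ω, (F n ω + ε / 2) + (B n).indicator 1 ω ∂P n := by
        refine lintegral_mono fun ω => ?_
        by_cases hω : ω ∈ B n
        · simpa [hω] using hc.trans le_add_self
        · simpa [hω] using (hbad n ω hω).2
      _ = ∫⁻ ω, F n ω ∂P n + ε / 2 + ∫⁻ ω, (B n).indicator 1 ω ∂P n := by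
        rw [lintegral_add_right _ hindm, lintegral_add_left (hF n)]
        simp
      _ ≤ ∫⁻ ω, F n ω ∂P n + ε / 2 + ε / 2 := by gcongr
      _ = ∫⁻ ω, F n ω ∂P n + ε := by rw [add_assoc, ENNReal.add_halves]
  · calc ∫⁻ ω, F n ω ∂P n
        ≤ ∫⁻ ω, (c + ε / 2) + (B n).indicator 1 ω ∂P n := by
          refine lintegral_mono fun ω => ?_
          by_cases hω : ω ∈ B n
          · simpa [hω] using (hF1 n ω).trans le_add_self
          · simpa [hω] using (hbad n ω hω).1
      _ = (c + ε / 2) + ∫⁻ ω, (B n).indicator 1 ω ∂P n := by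
        rw [lintegral_add_right _ hindm]
        simp
      _ ≤ c + ε / 2 + ε / 2 := by gcongr
      _ = c + ε := by rw [add_assoc, ENNReal.add_halves]

variable {X : Type*} [MetricSpace X] [SecondCountableTopology X] [MeasurableSpace X] [BorelSpace X]
  {Q : Measure (X × ℤ)} [IsProbabilityMeasure Q] {η : ℤ → X → ℝ≥0∞}

lemma measurable_nnPoint_left (n : ℕ) (q : X) :
    Measurable fun D : Fin (n + 1) → X × ℤ => nnPoint D q :=
  measurable_nnPoint.comp (measurable_id.prodMk measurable_const)

lemma measurable_nnLabel_left (n : ℕ) (q : X) :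
    Measurable fun D : Fin (n + 1) → X × ℤ => nnLabel D q :=
  measurable_nnLabel.comp (measurable_id.prodMk measurable_const)

lemma measurableSet_le_dist_nnPoint (n : ℕ) (q : X) (δ : ℝ) :
    MeasurableSet {D : Fin (n + 1) → X × ℤ | δ ≤ dist (nnPoint D q) q} :=
  measurableSet_le measurable_const ((measurable_nnPoint_left n q).dist measurable_const)

/-- The nearest neighbour converges in probability to the query point. -/
lemma tendsto_le_dist_nnPoint {q : X} {δ : ℝ}
    (hq : Q {p | dist p.1 q < δ} ≠ 0) :
    Tendsto (fun n : ℕ => Measure.pi (fun _ : Fin (n + 1) => Q)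
      {D | δ ≤ dist (nnPoint D q) q}) atTop (𝓝 0) := by
  have hm : MeasurableSet {p : X × ℤ | dist p.1 q < δ} :=
    measurableSet_lt (by fun_prop) measurable_const
  have hlt : Q {p | dist p.1 q < δ}ᶜ < 1 := by
    rw [prob_compl_eq_one_sub hm]
    exact ENNReal.sub_lt_self ENNReal.one_ne_top one_ne_zero hq
  refine tendsto_of_tendsto_of_tendsto_of_le_of_le tendsto_const_nhds
    ((tendsto_add_atTop_iff_nat 1).2 (ENNReal.tendsto_pow_atTop_nhds_zero_of_lt_one hlt))
    (fun _ => zero_le) fun n => ?_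
  -- If the nearest point is far, all `n + 1` independent points miss the ball, which has
  -- probability a power of a number below `1`.
  have hsub : {D : Fin (n + 1) → X × ℤ | δ ≤ dist (nnPoint D q) q} ⊆
      Set.univ.pi fun _ => {p : X × ℤ | dist p.1 q < δ}ᶜ := by
    intro D hD j _
    exact not_lt.2 (le_trans hD (dist_nnIndex_le (fun i => (D i).1) q j))
  refine (measure_mono hsub).trans ?_
  rw [Measure.pi_pi]
  simp

lemma ite_one_zero_le_one (p : Prop) [Decidable p] : (if p then 1 else 0 : ℝ≥0∞) ≤ 1 := by
  split_ifs <;> simp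

/-- The label of the nearest neighbour follows in the limit the posterior law at the query
point. -/
lemma IsPosterior.tendsto_nnLabel (hη : IsPosterior Q η) {a : ℤ} (hcont : Continuous (η a)) {q : X}
    (hq : ∀ δ : ℝ, 0 < δ → Q {p | dist p.1 q < δ} ≠ 0) :
    Tendsto (fun n : ℕ => ∫⁻ D, (if nnLabel D q = a then 1 else 0)
      ∂Measure.pi (fun _ : Fin (n + 1) => Q)) atTop (𝓝 (η a q)) := by
  have heq : ∀ n : ℕ, ∫⁻ D, (if nnLabel D q = a then 1 else 0)
      ∂Measure.pi (fun _ : Fin (n + 1) => Q) =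
      ∫⁻ D, η a (nnPoint D q) ∂Measure.pi (fun _ : Fin (n + 1) => Q) := fun n => by
    have := hη.lintegral_pi (n := n) (I := fun z => nnIndex z q)
      (measurable_nnIndex.comp (measurable_id.prodMk measurable_const))
      (G := fun _ => 1) measurable_const (fun _ _ _ _ => rfl) a
    simp only [one_mul] at this
    exact this
  simp_rw [heq]
  refine tendsto_lintegral_of_forall_bad
    (fun n => (hη.measurable a).comp (measurable_nnPoint_left n q))
    (fun n D => hη.le_one a _) (hη.le_one a q) fun ε hε => ?_
  have hev := (ENNReal.tendsto_nhds ((hη.le_one a q).trans_lt ENNReal.one_lt_top).ne).1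
    (hcont.tendsto q) ε hε
  obtain ⟨δ, hδ, hball⟩ := Metric.eventually_nhds_iff.1 hev
  refine ⟨fun n => {D | δ ≤ dist (nnPoint D q) q},
    fun n => measurableSet_le_dist_nnPoint n q δ, tendsto_le_dist_nnPoint (hq δ hδ),
    fun n D hD => ?_⟩
  have := hball (not_le.1 hD)
  exact ⟨this.2, tsub_le_iff_right.1 this.1⟩

/-- The labels of the nearest neighbours of two distinct points are independent in the limit. -/
lemma IsPosterior.tendsto_nnLabel_mul (hη : IsPosterior Q η) {a a' : ℤ}
    (hcont : Continuous (η a)) (hcont' : Continuous (η a')) {q q' : X} (hqq' : q ≠ q')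
    (hq : ∀ δ : ℝ, 0 < δ → Q {p | dist p.1 q < δ} ≠ 0)
    (hq' : ∀ δ : ℝ, 0 < δ → Q {p | dist p.1 q' < δ} ≠ 0) :
    Tendsto (fun n : ℕ => ∫⁻ D, (if nnLabel D q = a then 1 else 0) *
      (if nnLabel D q' = a' then 1 else 0)
      ∂Measure.pi (fun _ : Fin (n + 1) => Q)) atTop (𝓝 (η a q * η a' q')) := by
  classical
  have hIm : ∀ (n : ℕ) (x : X), Measurable fun z : Fin (n + 1) → X => nnIndex z x := fun n x =>
    measurable_nnIndex.comp (measurable_id.prodMk measurable_const)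
  have hIm' : ∀ (n : ℕ) (x : X), Measurable fun D : Fin (n + 1) → X × ℤ =>
      nnIndex (fun j => (D j).1) x := fun n x =>
    measurable_sample_nnIndex.comp (measurable_id.prodMk measurable_const)
  -- `N` and `M` indicate that the two queries have different or equal neighbours. On `N` the two
  -- labels can be averaged out in turn; `M` is asymptotically negligible.
  let N : ∀ n, (Fin (n + 1) → X × ℤ) → ℝ≥0∞ := fun n D =>
    if nnIndex (fun j => (D j).1) q = nnIndex (fun j => (D j).1) q' then 0 else 1
  let M : ∀ n, (Fin (n + 1) → X × ℤ) → ℝ≥0∞ := fun n D =>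
    if nnIndex (fun j => (D j).1) q = nnIndex (fun j => (D j).1) q' then 1 else 0
  have hset : ∀ n, MeasurableSet {D : Fin (n + 1) → X × ℤ |
      nnIndex (fun j => (D j).1) q = nnIndex (fun j => (D j).1) q'} := fun n =>
    measurableSet_eq_fun (hIm' n q) (hIm' n q')
  have hN : ∀ n, Measurable (N n) := fun n =>
    Measurable.ite (hset n) measurable_const measurable_const
  have hM : ∀ n, Measurable (M n) := fun n =>
    Measurable.ite (hset n) measurable_const measurable_const
  have hl : ∀ n, Measurable fun D : Fin (n + 1) → X × ℤ =>
      (if nnLabel D q = a then 1 else 0 : ℝ≥0∞) := fun n =>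
    measurable_label_ite (measurable_nnLabel_left n q) a
  have hl' : ∀ n, Measurable fun D : Fin (n + 1) → X × ℤ =>
      (if nnLabel D q' = a' then 1 else 0 : ℝ≥0∞) := fun n =>
    measurable_label_ite (measurable_nnLabel_left n q') a'
  have he : ∀ n, Measurable fun D : Fin (n + 1) → X × ℤ => η a (nnPoint D q) := fun n =>
    (hη.measurable a).comp (measurable_nnPoint_left n q)
  have he' : ∀ n, Measurable fun D : Fin (n + 1) → X × ℤ => η a' (nnPoint D q') := fun n =>
    (hη.measurable a').comp (measurable_nnPoint_left n q')
  have hfst : ∀ (n : ℕ) (D : Fin (n + 1) → X × ℤ) (i : Fin (n + 1)) (b : ℤ) (j : Fin (n + 1)),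
      (Function.update D i ((D i).1, b) j).1 = (D j).1 := by
    intro n D i b j
    by_cases hj : j = i
    · subst hj; simp
    · simp [hj]
  -- The factor `N` makes the weight admissible: relabelling the neighbour of `q` leaves the label
  -- at `q'` unchanged when the neighbours differ.
  have step1 : ∀ n, ∫⁻ D, (N n D * (if nnLabel D q' = a' then 1 else 0)) *
      (if nnLabel D q = a then 1 else 0) ∂Measure.pi (fun _ : Fin (n + 1) => Q) =
      ∫⁻ D, (N n D * (if nnLabel D q' = a' then 1 else 0)) * η a (nnPoint D q)
        ∂Measure.pi (fun _ : Fin (n + 1) => Q) := fun n => by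
    refine hη.lintegral_pi (hIm n q) (G := fun D => N n D * (if nnLabel D q' = a' then 1 else 0))
      ((hN n).mul (hl' n)) (fun D i b hi => ?_) a
    simp only [N, nnLabel, hfst]
    by_cases h1 : nnIndex (fun j => (D j).1) q = nnIndex (fun j => (D j).1) q'
    · simp only [h1, if_true, zero_mul]
    · rw [Function.update_of_ne fun h => h1 (hi.trans h.symm)]
      simp only [if_neg h1]
      congr
  have step2 : ∀ n, ∫⁻ D, (N n D * η a (nnPoint D q)) * (if nnLabel D q' = a' then 1 else 0)
      ∂Measure.pi (fun _ : Fin (n + 1) => Q) =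
      ∫⁻ D, (N n D * η a (nnPoint D q)) * η a' (nnPoint D q')
        ∂Measure.pi (fun _ : Fin (n + 1) => Q) := fun n => by
    refine hη.lintegral_pi (hIm n q') (G := fun D => N n D * η a (nnPoint D q))
      ((hN n).mul (he n)) (fun D i b hi => ?_) a'
    simp only [N, nnPoint, hfst]
  have hsum : ∀ n, ∫⁻ D, (if nnLabel D q = a then 1 else 0) *
      (if nnLabel D q' = a' then 1 else 0) ∂Measure.pi (fun _ : Fin (n + 1) => Q) =
      ∫⁻ D, N n D * (η a (nnPoint D q) * η a' (nnPoint D q'))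
        ∂Measure.pi (fun _ : Fin (n + 1) => Q) +
      ∫⁻ D, M n D * ((if nnLabel D q = a then 1 else 0) * (if nnLabel D q' = a' then 1 else 0))
        ∂Measure.pi (fun _ : Fin (n + 1) => Q) := fun n => by
    have e1 : ∫⁻ D, N n D * (η a (nnPoint D q) * η a' (nnPoint D q'))
        ∂Measure.pi (fun _ : Fin (n + 1) => Q) = ∫⁻ D, N n D *
          ((if nnLabel D q = a then 1 else 0) * (if nnLabel D q' = a' then 1 else 0))
          ∂Measure.pi (fun _ : Fin (n + 1) => Q) := by
      simp_rw [← mul_assoc]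
      rw [← step2 n]
      simp_rw [mul_right_comm _ (η a _)]
      rw [← step1 n]
      simp_rw [mul_right_comm]
    rw [e1, ← lintegral_add_left (f := fun D => N n D * ((if nnLabel D q = a then 1 else 0) *
      (if nnLabel D q' = a' then 1 else 0))) ((hN n).mul ((hl n).mul (hl' n)))]
    refine lintegral_congr fun D => ?_
    simp only [N, M]
    split_ifs <;> simp
  simp_rw [hsum]
  rw [← add_zero (η a q * η a' q')]
  have hle : η a q * η a' q' ≤ 1 := mul_le_one' (hη.le_one a q) (hη.le_one a' q')
  have hbadm : ∀ (δ : ℝ) (n : ℕ), MeasurableSet ({D : Fin (n + 1) → X × ℤ |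
      δ ≤ dist (nnPoint D q) q} ∪ {D | δ ≤ dist (nnPoint D q') q'}) := fun δ n =>
    (measurableSet_le_dist_nnPoint n q δ).union (measurableSet_le_dist_nnPoint n q' δ)
  have hbad : ∀ δ : ℝ, 0 < δ → Tendsto (fun n : ℕ => Measure.pi (fun _ : Fin (n + 1) => Q)
      ({D | δ ≤ dist (nnPoint D q) q} ∪ {D | δ ≤ dist (nnPoint D q') q'})) atTop (𝓝 0) := by
    intro δ hδ
    refine tendsto_of_tendsto_of_tendsto_of_le_of_le tendsto_const_nhds ?_
      (fun _ => zero_le) fun n => measure_union_le _ _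
    simpa using (tendsto_le_dist_nnPoint (hq δ hδ)).add (tendsto_le_dist_nnPoint (hq' δ hδ))
  have hne : ∀ᶠ z : X × X in 𝓝 (q, q'), z.1 ≠ z.2 :=
    (isOpen_ne_fun continuous_fst continuous_snd).mem_nhds hqq'
  refine Tendsto.add ?_ ?_
  · refine tendsto_lintegral_of_forall_bad
      (F := fun n D => N n D * (η a (nnPoint D q) * η a' (nnPoint D q')))
      (fun n => (hN n).mul ((he n).mul (he' n)))
      (fun n D => mul_le_one' (by simp only [N]; split_ifs <;> simp)
        (mul_le_one' (hη.le_one a _) (hη.le_one a' _))) hle fun ε hε => ?_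
    have hct : Tendsto (fun z : X × X => η a z.1 * η a' z.2) (𝓝 (q, q'))
        (𝓝 (η a q * η a' q')) :=
      ENNReal.Tendsto.mul ((hcont.comp continuous_fst).tendsto (q, q'))
        (Or.inr ((hη.le_one a' q').trans_lt ENNReal.one_lt_top).ne)
        ((hcont'.comp continuous_snd).tendsto (q, q'))
        (Or.inr ((hη.le_one a q).trans_lt ENNReal.one_lt_top).ne)
    have hev := (ENNReal.tendsto_nhds (hle.trans_lt ENNReal.one_lt_top).ne).1 hct ε hε
    obtain ⟨δ, hδ, hball⟩ := Metric.eventually_nhds_iff.1 (hev.and hne)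
    refine ⟨_, hbadm δ, hbad δ hδ, fun n D hD => ?_⟩
    simp only [Set.mem_union, Set.mem_ofPred_eq, not_or, not_le] at hD
    have := hball (y := (nnPoint D q, nnPoint D q'))
      (by rw [Prod.dist_eq]; exact max_lt hD.1 hD.2)
    have hN1 : N n D = 1 := if_neg fun h => this.2 (by simp [nnPoint, h])
    simp only [hN1, one_mul]
    exact ⟨this.1.2, tsub_le_iff_right.1 this.1.1⟩
  · refine tendsto_lintegral_of_forall_bad (fun n => (hM n).mul ((hl n).mul (hl' n)))
      (fun n D => mul_le_one' (ite_one_zero_le_one _)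
        (mul_le_one' (ite_one_zero_le_one _) (ite_one_zero_le_one _))) zero_le fun ε hε => ?_
    -- Neighbours close enough to two distinct queries are distinct, so `M` vanishes outside the bad
    -- set.
    obtain ⟨δ, hδ, hball⟩ := Metric.eventually_nhds_iff.1 hne
    refine ⟨_, hbadm δ, hbad δ hδ, fun n D hD => ?_⟩
    simp only [Set.mem_union, Set.mem_ofPred_eq, not_or, not_le] at hD
    have := hball (y := (nnPoint D q, nnPoint D q'))
      (by rw [Prod.dist_eq]; exact max_lt hD.1 hD.2)
    have hM0 : M n D = 0 := if_neg fun h => this (by simp [nnPoint, h])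
    simp [hM0]

end Limits

/-! ### Convergence of the error, in probability and on average. -/

section Consistency

/-- Convergence in probability to a constant from convergence of the first two moments. -/
lemma tendsto_measure_le_abs_sub_of_moments {Ω : ℕ → Type*} [∀ n, MeasurableSpace (Ω n)]
    {P : ∀ n, Measure (Ω n)} [∀ n, IsProbabilityMeasure (P n)] {f : ∀ n, Ω n → ℝ} {α : ℝ}
    (hf : ∀ n, MemLp (f n) 2 (P n))
    (h1 : Tendsto (fun n => ∫ ω, f n ω ∂P n) atTop (𝓝 α))
    (h2 : Tendsto (fun n => ∫ ω, f n ω ^ 2 ∂P n) atTop (𝓝 (α ^ 2))) {ε : ℝ} (hε : 0 < ε) :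
    Tendsto (fun n => P n {ω | ε ≤ |f n ω - α|}) atTop (𝓝 0) := by
  have hint : ∀ n, Integrable (f n) (P n) := fun n => (hf n).integrable one_le_two
  have hint2 : ∀ n, Integrable (fun ω => f n ω ^ 2) (P n) := fun n => (hf n).integrable_sq
  have hI : ∀ n, Integrable (fun ω => (f n ω - α) ^ 2) (P n) := fun n =>
    ((hf n).sub (memLp_const α)).integrable_sq
  have hexp : ∀ n, ∫ ω, (f n ω - α) ^ 2 ∂P n =
      ∫ ω, f n ω ^ 2 ∂P n - 2 * α * ∫ ω, f n ω ∂P n + α ^ 2 := fun n => by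
    have : ∀ ω, (f n ω - α) ^ 2 = f n ω ^ 2 - 2 * α * f n ω + α ^ 2 := fun ω => by ring
    simp_rw [this]
    rw [integral_add (f := fun ω => f n ω ^ 2 - 2 * α * f n ω)
      ((hint2 n).sub ((hint n).const_mul _)) (integrable_const _),
      integral_sub (hint2 n) ((hint n).const_mul _), integral_const_mul]
    simp
  have hlim : Tendsto (fun n => ∫ ω, (f n ω - α) ^ 2 ∂P n) atTop (𝓝 0) := by
    simp_rw [hexp]
    have := (h2.sub (h1.const_mul (2 * α))).add_const (α ^ 2)
    rwa [show α ^ 2 - 2 * α * α + α ^ 2 = 0 by ring] at this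
  have hreal : Tendsto (fun n => (P n).real {ω | ε ≤ |f n ω - α|}) atTop (𝓝 0) := by
    have hdiv := hlim.div_const (ε ^ 2)
    rw [zero_div] at hdiv
    refine squeeze_zero (fun n => measureReal_nonneg) (fun n => ?_) hdiv
    rw [le_div_iff₀ (by positivity), mul_comm]
    have hset : {ω | ε ≤ |f n ω - α|} = {ω | ε ^ 2 ≤ (f n ω - α) ^ 2} := by
      ext ω
      simp only [Set.mem_ofPred_eq]
      rw [← sq_abs (f n ω - α)]
      exact (pow_le_pow_iff_left₀ hε.le (abs_nonneg _) two_ne_zero).symm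
    rw [hset]
    exact mul_meas_ge_le_integral_of_nonneg (ae_of_all _ fun ω => sq_nonneg _) (hI n) _
  exact (ENNReal.tendsto_toReal_zero_iff fun n => measure_ne_top _ _).1 hreal

variable {X : Type*} [MetricSpace X] [SecondCountableTopology X] [MeasurableSpace X] [BorelSpace X]

lemma measurableSet_nnLabel_eq (n : ℕ) :
    MeasurableSet {z : (Fin (n + 1) → X × ℤ) × (X × ℤ) | nnLabel z.1 z.2.1 = z.2.2} := by
  have : Measurable fun z : (Fin (n + 1) → X × ℤ) × (X × ℤ) => (z.1, z.2.1) := by fun_prop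
  exact measurableSet_eq_fun (measurable_nnLabel.comp this) (measurable_snd.comp measurable_snd)

lemma measurable_nnLabel_ite (n : ℕ) :
    Measurable fun z : (Fin (n + 1) → X × ℤ) × (X × ℤ) =>
      (if nnLabel z.1 z.2.1 = z.2.2 then 1 else 0 : ℝ≥0∞) :=
  Measurable.ite (measurableSet_nnLabel_eq n) measurable_const measurable_const

/-- The probability that the nearest neighbour rule with sample `D` labels a test pair
correctly. -/
lemma lintegral_nnLabel_ite {T : Measure (X × ℤ)} {n : ℕ}
    (D : Fin (n + 1) → X × ℤ) :
    ∫⁻ p, (if nnLabel D p.1 = p.2 then 1 else 0) ∂T = T {p | nnLabel D p.1 = p.2} := by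
  have hm : MeasurableSet {p : X × ℤ | nnLabel D p.1 = p.2} :=
    measurable_prodMk_left (x := D) (measurableSet_nnLabel_eq n)
  rw [← lintegral_indicator_one hm]
  refine lintegral_congr fun p => ?_
  simp [Set.indicator_apply]

variable {Q T : Measure (X × ℤ)} [IsProbabilityMeasure Q] [IsProbabilityMeasure T]
  {η : ℤ → X → ℝ≥0∞}

/-- Fubini moves the test pair outside, where the limit is known pointwise; dominated convergence
with bound `1` finishes. -/
lemma IsPosterior.tendsto_lintegral_accuracy (hη : IsPosterior Q η) (hcont : ∀ a, Continuous (η a))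
    (hsupp : ∀ᵐ p ∂T, ∀ δ : ℝ, 0 < δ → Q {p' | dist p'.1 p.1 < δ} ≠ 0) :
    Tendsto (fun n : ℕ => ∫⁻ D, T {p | nnLabel D p.1 = p.2}
      ∂Measure.pi (fun _ : Fin (n + 1) => Q)) atTop (𝓝 (∫⁻ p, η p.2 p.1 ∂T)) := by
  simp_rw [← lintegral_nnLabel_ite]
  have hswap : ∀ n : ℕ, ∫⁻ D, ∫⁻ p, (if nnLabel D p.1 = p.2 then 1 else 0) ∂T
      ∂Measure.pi (fun _ : Fin (n + 1) => Q) = ∫⁻ p, ∫⁻ D, (if nnLabel D p.1 = p.2 then 1 else 0)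
      ∂Measure.pi (fun _ : Fin (n + 1) => Q) ∂T := fun n =>
    lintegral_lintegral_swap (measurable_nnLabel_ite n).aemeasurable
  simp_rw [hswap]
  refine tendsto_lintegral_of_dominated_convergence (fun _ => 1)
    (fun n => (measurable_nnLabel_ite n).lintegral_prod_left')
    (fun n => ae_of_all _ fun p => ?_) (by simp) ?_
  · exact (lintegral_mono fun D => ite_one_zero_le_one _).trans_eq (by simp)
  · filter_upwards [hsupp] with p hp
    exact hη.tendsto_nnLabel (hcont p.2) hp

/-- The squared accuracy is the probability of being right on two independent test pairs. These have
distinct points almost surely because `T` has no atoms in the first coordinate, so the two labels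
decouple in the limit. -/
lemma IsPosterior.tendsto_lintegral_accuracy_sq (hη : IsPosterior Q η)
    (hcont : ∀ a, Continuous (η a))
    (hsupp : ∀ᵐ p ∂T, ∀ δ : ℝ, 0 < δ → Q {p' | dist p'.1 p.1 < δ} ≠ 0)
    (hatom : ∀ q, T {p | p.1 = q} = 0) :
    Tendsto (fun n : ℕ => ∫⁻ D, T {p | nnLabel D p.1 = p.2} ^ 2
      ∂Measure.pi (fun _ : Fin (n + 1) => Q)) atTop (𝓝 ((∫⁻ p, η p.2 p.1 ∂T) ^ 2)) := by
  have hm : ∀ n : ℕ, Measurable fun z : (Fin (n + 1) → X × ℤ) × ((X × ℤ) × (X × ℤ)) =>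
      (if nnLabel z.1 z.2.1.1 = z.2.1.2 then 1 else 0 : ℝ≥0∞) *
        (if nnLabel z.1 z.2.2.1 = z.2.2.2 then 1 else 0) := fun n => by
    have e1 : Measurable fun z : (Fin (n + 1) → X × ℤ) × ((X × ℤ) × (X × ℤ)) => (z.1, z.2.1) := by
      fun_prop
    have e2 : Measurable fun z : (Fin (n + 1) → X × ℤ) × ((X × ℤ) × (X × ℤ)) => (z.1, z.2.2) := by
      fun_prop
    exact ((measurable_nnLabel_ite n).comp e1).mul ((measurable_nnLabel_ite n).comp e2)
  have hsq : ∀ n : ℕ, ∫⁻ D, T {p | nnLabel D p.1 = p.2} ^ 2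
      ∂Measure.pi (fun _ : Fin (n + 1) => Q) =
      ∫⁻ z, ∫⁻ D, (if nnLabel D z.1.1 = z.1.2 then 1 else 0) *
        (if nnLabel D z.2.1 = z.2.2 then 1 else 0)
        ∂Measure.pi (fun _ : Fin (n + 1) => Q) ∂T.prod T := fun n => by
    rw [← lintegral_lintegral_swap (hm n).aemeasurable]
    refine lintegral_congr fun D => ?_
    have hD : Measurable fun p : X × ℤ => (if nnLabel D p.1 = p.2 then 1 else 0 : ℝ≥0∞) :=
      (measurable_nnLabel_ite n).comp measurable_prodMk_left
    rw [lintegral_prod_mul hD.aemeasurable hD.aemeasurable, lintegral_nnLabel_ite, sq]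
  simp_rw [hsq]
  have hlim : (∫⁻ p, η p.2 p.1 ∂T) ^ 2 =
      ∫⁻ z : (X × ℤ) × (X × ℤ), η z.1.2 z.1.1 * η z.2.2 z.2.1 ∂T.prod T := by
    rw [lintegral_prod_mul (f := fun p : X × ℤ => η p.2 p.1) (g := fun p : X × ℤ => η p.2 p.1)
      hη.measurable_uncurry.aemeasurable hη.measurable_uncurry.aemeasurable, sq]
  rw [hlim]
  have hne : ∀ᵐ z ∂T.prod T, z.1.1 ≠ z.2.1 := by
    have hs : MeasurableSet {z : (X × ℤ) × (X × ℤ) | z.1.1 = z.2.1} :=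
      measurableSet_eq_fun (by fun_prop) (by fun_prop)
    have : T.prod T {z : (X × ℤ) × (X × ℤ) | z.1.1 = z.2.1} = 0 := by
      rw [Measure.measure_prod_null hs]
      refine ae_of_all _ fun p => ?_
      have := hatom p.1
      simpa [eq_comm] using this
    simpa [ae_iff] using this
  have hs1 : ∀ᵐ z ∂T.prod T, ∀ δ : ℝ, 0 < δ → Q {p' | dist p'.1 z.1.1 < δ} ≠ 0 :=
    Measure.quasiMeasurePreserving_fst.ae hsupp
  have hs2 : ∀ᵐ z ∂T.prod T, ∀ δ : ℝ, 0 < δ → Q {p' | dist p'.1 z.2.1 < δ} ≠ 0 :=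
    Measure.quasiMeasurePreserving_snd.ae hsupp
  refine tendsto_lintegral_of_dominated_convergence (fun _ => 1)
    (fun n => (hm n).lintegral_prod_left') (fun n => ae_of_all _ fun p => ?_) (by simp) ?_
  · exact (lintegral_mono fun D => mul_le_one' (ite_one_zero_le_one _)
      (ite_one_zero_le_one _)).trans_eq (by simp)
  · filter_upwards [hne, hs1, hs2] with z hz h1 h2
    exact hη.tendsto_nnLabel_mul (hcont _) (hcont _) hz h1 h2

/-- The labelling error of the nearest neighbour rule, under a test law `T` without atoms that may
differ from the training law `Q`, converges to the probability that a label drawn from the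
training posterior at the test point is wrong. -/
theorem IsPosterior.tendsto_nnLabel_error (hη : IsPosterior Q η) (hcont : ∀ a, Continuous (η a))
    (hsupp : ∀ᵐ p ∂T, ∀ δ : ℝ, 0 < δ → Q {p' | dist p'.1 p.1 < δ} ≠ 0)
    (hatom : ∀ q, T {p | p.1 = q} = 0) :
    (∀ ε : ℝ, 0 < ε → Tendsto (fun n : ℕ => Measure.pi (fun _ : Fin (n + 1) => Q)
      {D | ε ≤ |T.real {p | nnLabel D p.1 ≠ p.2} - (1 - (∫⁻ p, η p.2 p.1 ∂T).toReal)|})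
      atTop (𝓝 0)) ∧
    Tendsto (fun n : ℕ => ((Measure.pi (fun _ : Fin (n + 1) => Q)).prod T).real
      {z | nnLabel z.1 z.2.1 ≠ z.2.2}) atTop (𝓝 (1 - (∫⁻ p, η p.2 p.1 ∂T).toReal)) := by
  have hα : ∫⁻ p, η p.2 p.1 ∂T ≠ ∞ :=
    ((lintegral_mono fun p : X × ℤ => hη.le_one p.2 p.1).trans_lt (by simp)).ne
  have h1 := hη.tendsto_lintegral_accuracy hcont hsupp
  have h2 := hη.tendsto_lintegral_accuracy_sq hcont hsupp hatom
  have hmeas : ∀ n : ℕ, Measurable fun D : Fin (n + 1) → X × ℤ =>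
      T {p | nnLabel D p.1 = p.2} := fun n =>
    measurable_measure_prodMk_left (measurableSet_nnLabel_eq n)
  have hsec : ∀ (n : ℕ) (D : Fin (n + 1) → X × ℤ), MeasurableSet {p : X × ℤ |
      nnLabel D p.1 = p.2} := fun n D =>
    measurable_prodMk_left (x := D) (measurableSet_nnLabel_eq n)
  constructor
  · intro ε hε
    have hcompl : ∀ (n : ℕ) (D : Fin (n + 1) → X × ℤ), T.real {p | nnLabel D p.1 ≠ p.2} =
        1 - T.real {p | nnLabel D p.1 = p.2} := fun n D => by
      rw [← probReal_compl_eq_one_sub (hsec n D)]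
      rfl
    have habs : ∀ x y : ℝ, |1 - x - (1 - y)| = |x - y| := fun x y => by
      rw [← abs_neg (x - y)]
      ring_nf
    simp_rw [hcompl, habs]
    refine tendsto_measure_le_abs_sub_of_moments (fun n => ?_) ?_ ?_ hε
    · refine MemLp.of_bound (hmeas n).ennreal_toReal.aestronglyMeasurable 1
        (ae_of_all _ fun D => ?_)
      rw [Real.norm_eq_abs, abs_of_nonneg measureReal_nonneg]
      exact measureReal_le_one
    · have := (ENNReal.tendsto_toReal hα).comp h1
      refine this.congr fun n => ?_
      simp only [Function.comp_apply, Measure.real]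
      rw [integral_toReal (hmeas n).aemeasurable (ae_of_all _ fun D => measure_lt_top _ _)]
    · have := (ENNReal.tendsto_toReal (ENNReal.pow_ne_top hα)).comp h2
      rw [ENNReal.toReal_pow] at this
      refine this.congr fun n => ?_
      simp only [Function.comp_apply, Measure.real, ← ENNReal.toReal_pow]
      rw [integral_toReal ((hmeas n).pow_const 2).aemeasurable
        (ae_of_all _ fun D => ENNReal.pow_lt_top (measure_lt_top _ _))]
  · have := ((ENNReal.tendsto_toReal hα).comp h1).const_sub 1
    refine this.congr fun n => ?_
    have hc : {z : (Fin (n + 1) → X × ℤ) × (X × ℤ) | nnLabel z.1 z.2.1 ≠ z.2.2} =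
      {z | nnLabel z.1 z.2.1 = z.2.2}ᶜ := rfl
    rw [hc, probReal_compl_eq_one_sub (measurableSet_nnLabel_eq n), Measure.real,
      Measure.prod_apply (measurableSet_nnLabel_eq n)]
    rfl

end Consistency

/-! ### Exponential moments determine a measure. -/

section ExponentialMoments

variable {E : Type*} [NormedAddCommGroup E] [InnerProductSpace ℝ E] [CompleteSpace E]
  [SecondCountableTopology E] [MeasurableSpace E] [BorelSpace E]

/-- Two measures with the same finite exponential moments are equal. -/
lemma ext_of_lintegral_exp_inner {ρ ρ' : Measure E} [IsProbabilityMeasure ρ]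
    (hfin : ∀ t : E, ∫⁻ x, ENNReal.ofReal (Real.exp (inner ℝ t x)) ∂ρ ≠ ∞)
    (heq : ∀ t : E, ∫⁻ x, ENNReal.ofReal (Real.exp (inner ℝ t x)) ∂ρ =
      ∫⁻ x, ENNReal.ofReal (Real.exp (inner ℝ t x)) ∂ρ') : ρ = ρ' := by
  have : IsFiniteMeasure ρ' := ⟨by
    have := heq 0
    simp only [inner_zero_left, Real.exp_zero, ENNReal.ofReal_one, lintegral_one] at this
    rw [← this]
    exact measure_lt_top _ _⟩
  have hm : ∀ t : E, Measurable fun x : E => Real.exp (inner ℝ t x) := fun t => by fun_prop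
  have hint : ∀ t : E, Integrable (fun x => Real.exp (inner ℝ t x)) ρ := fun t => by
    refine ⟨(hm t).aestronglyMeasurable, ?_⟩
    rw [hasFiniteIntegral_iff_ofReal (ae_of_all _ fun x => (Real.exp_pos _).le)]
    exact lt_top_iff_ne_top.2 (hfin t)
  have hexp : ∀ t : E, ∫ x, Real.exp (inner ℝ t x) ∂ρ = ∫ x, Real.exp (inner ℝ t x) ∂ρ' :=
    fun t => by
    rw [integral_eq_lintegral_of_nonneg_ae (ae_of_all _ fun x => (Real.exp_pos _).le)
        (hm t).aestronglyMeasurable, heq t,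
      integral_eq_lintegral_of_nonneg_ae (ae_of_all _ fun x => (Real.exp_pos _).le)
        (hm t).aestronglyMeasurable]
  refine Measure.ext_of_charFun (funext fun t => ?_)
  have hmgf : mgf (fun x : E => inner ℝ t x) ρ = mgf (fun x : E => inner ℝ t x) ρ' := by
    ext s
    simp only [mgf, ← real_inner_smul_left]
    exact hexp (s • t)
  have huniv : integrableExpSet (fun x : E => inner ℝ t x) ρ = Set.univ := by
    ext s
    simp only [integrableExpSet, ← real_inner_smul_left, Set.mem_univ, iff_true]
    exact hint (s • t)
  -- As the moments are finite everywhere, equality of the real moment generating functions extends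
  -- analytically to the complex plane; the value at `I` is the characteristic function.
  have := eqOn_complexMGF_of_mgf hmgf (x := Complex.I) (by simp [huniv])
  simp only [complexMGF] at this
  simp only [charFun_apply, real_inner_comm t, mul_comm _ Complex.I]
  exact this

end ExponentialMoments

/-! ### Multivariate Gaussians: marginals, change of mean, full support. -/

section Gaussian

variable {d : ℕ} {m : EuclideanSpace ℝ (Fin d)} {S : Matrix (Fin d) (Fin d) ℝ}

lemma multivariateGaussian_map_inner (hS : S.PosSemidef) (t : EuclideanSpace ℝ (Fin d)) :
    (multivariateGaussian m S).map (fun x => inner ℝ t x) =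
      gaussianReal (inner ℝ t m) (inner ℝ t (toEuclideanCLM (𝕜 := ℝ) S t)).toNNReal := by
  have h := IsGaussian.map_eq_gaussianReal (μ := multivariateGaussian m S) (innerSL ℝ t)
  have hmean : (multivariateGaussian m S)[innerSL ℝ t] = inner ℝ t m := by
    rw [ContinuousLinearMap.integral_comp_id_comm IsGaussian.integrable_id]
    simp
  have hvar : Var[innerSL ℝ t; multivariateGaussian m S] =
      inner ℝ t (toEuclideanCLM (𝕜 := ℝ) S t) := by
    rw [inner_toEuclideanCLM, ← covarianceBilin_multivariateGaussian (μ := m) hS,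
      covarianceBilin_self IsGaussian.memLp_two_id]
    rfl
  rw [hmean, hvar] at h
  exact h

lemma inner_toEuclideanCLM_nonneg (hS : S.PosSemidef) (t : EuclideanSpace ℝ (Fin d)) :
    0 ≤ inner ℝ t (toEuclideanCLM (𝕜 := ℝ) S t) := by
  rw [inner_toEuclideanCLM]
  simpa using hS.dotProduct_mulVec_nonneg t.ofLp

lemma lintegral_exp_inner_multivariateGaussian (hS : S.PosSemidef)
    (t : EuclideanSpace ℝ (Fin d)) :
    ∫⁻ x, ENNReal.ofReal (Real.exp (inner ℝ t x)) ∂multivariateGaussian m S =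
      ENNReal.ofReal (Real.exp (inner ℝ t m + inner ℝ t (toEuclideanCLM (𝕜 := ℝ) S t) / 2)) := by
  have hlaw := multivariateGaussian_map_inner (m := m) hS t
  have hint : Integrable (fun x => Real.exp (inner ℝ t x)) (multivariateGaussian m S) := by
    have h := integrable_exp_mul_gaussianReal (μ := inner ℝ t m)
      (v := (inner ℝ t (toEuclideanCLM (𝕜 := ℝ) S t)).toNNReal) 1
    rw [← hlaw] at h
    simpa [Function.comp_def] using (integrable_map_measure (by fun_prop) (by fun_prop)).1 h
  rw [← ofReal_integral_eq_lintegral_ofReal hint (ae_of_all _ fun x => (Real.exp_pos _).le)]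
  have := mgf_gaussianReal hlaw 1
  simp only [mgf, one_mul, mul_one, one_pow,
    Real.coe_toNNReal _ (inner_toEuclideanCLM_nonneg hS t)] at this
  rw [this]

/-- The Cameron-Martin formula for the image under a symmetric operator `φ` of the two class
conditionals `N(m, S)` and `N(-m, S)`. -/
lemma multivariateGaussian_map_eq_withDensity (hS : S.PosSemidef)
    {φ : EuclideanSpace ℝ (Fin d) →L[ℝ] EuclideanSpace ℝ (Fin d)}
    (hφ : ∀ x y, inner ℝ (φ x) y = inner ℝ x (φ y)) {u : EuclideanSpace ℝ (Fin d)}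
    (hu : φ (toEuclideanCLM (𝕜 := ℝ) S (φ u)) = φ m) :
    (multivariateGaussian m S).map φ = ((multivariateGaussian (-m) S).map φ).withDensity
      fun z => ENNReal.ofReal (Real.exp (2 * inner ℝ u z)) := by
  have hmap : ∀ (m' t : EuclideanSpace ℝ (Fin d)),
      ∫⁻ z, ENNReal.ofReal (Real.exp (inner ℝ t z)) ∂(multivariateGaussian m' S).map φ =
      ENNReal.ofReal (Real.exp (inner ℝ t (φ m') +
        inner ℝ t (φ (toEuclideanCLM (𝕜 := ℝ) S (φ t))) / 2)) := fun m' t => by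
    rw [lintegral_map (by fun_prop) (by fun_prop)]
    simp only [← hφ]
    exact lintegral_exp_inner_multivariateGaussian hS (φ t)
  have : IsProbabilityMeasure ((multivariateGaussian m S).map φ) :=
    Measure.isProbabilityMeasure_map (by fun_prop)
  have hsymm : ∀ x y : EuclideanSpace ℝ (Fin d), inner ℝ x (φ (toEuclideanCLM (𝕜 := ℝ) S (φ y))) =
      inner ℝ y (φ (toEuclideanCLM (𝕜 := ℝ) S (φ x))) := fun x y => by
    rw [← hφ, ← hφ, inner_toEuclideanCLM, inner_toEuclideanCLM,
      ← covarianceBilin_multivariateGaussian (μ := m) hS,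
      ← covarianceBilin_multivariateGaussian (μ := m) hS, covarianceBilin_comm]
  refine ext_of_lintegral_exp_inner (fun t => by rw [hmap]; exact ENNReal.ofReal_ne_top)
    fun t => ?_
  rw [hmap, lintegral_withDensity_eq_lintegral_mul _ (by fun_prop) (by fun_prop)]
  have hmul : ∀ z : EuclideanSpace ℝ (Fin d),
      ((fun z => ENNReal.ofReal (Real.exp (2 * inner ℝ u z))) *
      fun z => ENNReal.ofReal (Real.exp (inner ℝ t z))) z =
      ENNReal.ofReal (Real.exp (inner ℝ (t + (2 : ℝ) • u) z)) := fun z => by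
    simp only [Pi.mul_apply]
    rw [← ENNReal.ofReal_mul (Real.exp_pos _).le, ← Real.exp_add, inner_add_left,
      real_inner_smul_left, add_comm]
  rw [lintegral_congr hmul, hmap]
  -- Completing the square at `t + 2 u`: the cross term contributes `2⟪t, φ m⟫`, turning `-⟪t, φ m⟫`
  -- into `⟪t, φ m⟫`, and the pure `u` terms cancel.
  congr 2
  have e1 := hsymm u t
  rw [hu] at e1
  simp only [map_add, map_smul, map_neg, inner_add_left, inner_add_right, real_inner_smul_left,
    real_inner_smul_right, inner_neg_right, hu, e1]
  ring

instance isOpenPosMeasure_gaussianReal : (gaussianReal 0 1).IsOpenPosMeasure :=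
  (gaussianReal_absolutelyContinuous' 0 one_ne_zero).isOpenPosMeasure

-- The law is the image of a standard Gaussian under an affine map, surjective because `CFC.sqrt S`
-- is invertible when `S` is positive definite.
open scoped MatrixOrder in
lemma isOpenPosMeasure_multivariateGaussian (hS : S.PosDef) :
    (multivariateGaussian m S).IsOpenPosMeasure := by
  have hstd : (stdGaussian (EuclideanSpace ℝ (Fin d))).IsOpenPosMeasure := by
    rw [← map_pi_eq_stdGaussian]
    exact (PiLp.continuous_toLp 2 _).isOpenPosMeasure_map (WithLp.toLp_surjective 2)
  have hdet : IsUnit (CFC.sqrt S) := by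
    rw [Matrix.isUnit_iff_isUnit_det]
    have h := hS.det_pos.ne'
    rw [← CFC.sqrt_mul_sqrt_self S hS.posSemidef.nonneg, Matrix.det_mul] at h
    exact (left_ne_zero_of_mul h).isUnit
  rw [multivariateGaussian]
  refine Continuous.isOpenPosMeasure_map (by fun_prop) fun y => ?_
  have hu := hdet.map (toEuclideanCLM (n := Fin d) (𝕜 := ℝ))
  obtain ⟨g, hg⟩ := hu.exists_right_inv
  refine ⟨g (y - m), ?_⟩
  have := congrArg (fun f => f (y - m)) hg
  simp only [mul_apply_eq_comp, one_apply_eq_self] at this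
  rw [this]
  simp

end Gaussian

/-! ### The represented training and test laws, and the logistic posterior. -/

section LabelledLaw

variable {d : ℕ} {m : EuclideanSpace ℝ (Fin d)} {S : Matrix (Fin d) (Fin d) ℝ}
  {φ : EuclideanSpace ℝ (Fin d) →L[ℝ] EuclideanSpace ℝ (Fin d)}

lemma lintegral_balancedGaussianPair {F : EuclideanSpace ℝ (Fin d) × ℤ → ℝ≥0∞}
    (hF : Measurable F) :
    ∫⁻ p, F p ∂balancedGaussianPair m S =
      1 / 2 * ∫⁻ x, F (x, 1) ∂multivariateGaussian m S +
        1 / 2 * ∫⁻ x, F (x, -1) ∂multivariateGaussian (-m) S := by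
  rw [balancedGaussianPair, lintegral_add_measure, lintegral_smul_measure, lintegral_smul_measure,
    lintegral_map hF (by fun_prop), lintegral_map hF (by fun_prop)]
  rfl

instance isProbabilityMeasure_balancedGaussianPair :
    IsProbabilityMeasure (balancedGaussianPair m S) := ⟨by
  rw [← lintegral_one, lintegral_balancedGaussianPair measurable_const]
  simp [ENNReal.inv_two_add_inv_two]⟩

variable (m S φ) in
/-- The law of `(φ x, y)` for a balanced Gaussian pair `(x, y)`. -/
noncomputable def representedPair : Measure (EuclideanSpace ℝ (Fin d) × ℤ) :=
  (balancedGaussianPair m S).map fun p => (φ p.1, p.2)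

lemma measurable_represent :
    Measurable fun p : EuclideanSpace ℝ (Fin d) × ℤ => (φ p.1, p.2) := by fun_prop

instance isProbabilityMeasure_representedPair : IsProbabilityMeasure (representedPair m S φ) :=
  Measure.isProbabilityMeasure_map measurable_represent.aemeasurable

lemma lintegral_representedPair {F : EuclideanSpace ℝ (Fin d) × ℤ → ℝ≥0∞} (hF : Measurable F) :
    ∫⁻ p, F p ∂representedPair m S φ =
      1 / 2 * ∫⁻ x, F (φ x, 1) ∂multivariateGaussian m S +
        1 / 2 * ∫⁻ x, F (φ x, -1) ∂multivariateGaussian (-m) S := by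
  rw [representedPair, lintegral_map hF measurable_represent,
    lintegral_balancedGaussianPair (F := fun p => F (φ p.1, p.2))
      (hF.comp measurable_represent)]

/-- The posterior probability of the label `a` in the logistic model with direction `2 u`. -/
noncomputable def logisticPosterior (u : EuclideanSpace ℝ (Fin d)) (a : ℤ)
    (z : EuclideanSpace ℝ (Fin d)) : ℝ≥0∞ :=
  if a = 1 then ENNReal.ofReal (Real.sigmoid (2 * inner ℝ u z))
  else if a = -1 then ENNReal.ofReal (Real.sigmoid (-(2 * inner ℝ u z))) else 0

lemma continuous_logisticPosterior (u : EuclideanSpace ℝ (Fin d)) (a : ℤ) :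
    Continuous (logisticPosterior u a) := by
  unfold logisticPosterior
  split_ifs
  · exact ENNReal.continuous_ofReal.comp (continuous_sigmoid.comp (by fun_prop))
  · exact ENNReal.continuous_ofReal.comp (continuous_sigmoid.comp (by fun_prop))
  · exact continuous_const

lemma logisticPosterior_le_one (u : EuclideanSpace ℝ (Fin d)) (a : ℤ)
    (z : EuclideanSpace ℝ (Fin d)) : logisticPosterior u a z ≤ 1 := by
  unfold logisticPosterior
  split_ifs
  · exact ENNReal.ofReal_le_one.2 (Real.sigmoid_le_one _)
  · exact ENNReal.ofReal_le_one.2 (Real.sigmoid_le_one _)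
  · exact zero_le

lemma sigmoid_mul_exp_add_sigmoid (s : ℝ) :
    Real.exp s * Real.sigmoid s + Real.sigmoid s = Real.exp s := by
  rw [Real.sigmoid_def, Real.exp_neg]
  have := Real.exp_pos s
  field_simp

lemma sigmoid_neg_mul_exp_add_sigmoid (s : ℝ) :
    Real.exp s * Real.sigmoid (-s) + Real.sigmoid (-s) = 1 := by
  rw [Real.sigmoid_def, neg_neg]
  have := Real.exp_pos s
  field_simp
  ring

/-- The posterior of the label given the represented point is logistic. -/
lemma isPosterior_representedPair (hS : S.PosSemidef)
    (hφ : ∀ x y, inner ℝ (φ x) y = inner ℝ x (φ y)) {u : EuclideanSpace ℝ (Fin d)}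
    (hu : φ (toEuclideanCLM (𝕜 := ℝ) S (φ u)) = φ m) :
    IsPosterior (representedPair m S φ) (logisticPosterior u) where
  measurable a := (continuous_logisticPosterior u a).measurable
  le_one := logisticPosterior_le_one u
  lintegral_eq a h hh := by
    have hη : Measurable (logisticPosterior u a) := (continuous_logisticPosterior u a).measurable
    have hF : Measurable fun p : EuclideanSpace ℝ (Fin d) × ℤ =>
        h p.1 * (if p.2 = a then 1 else 0) :=
      (hh.comp measurable_fst).mul (measurable_label_ite measurable_snd a)
    have hF' : Measurable fun p : EuclideanSpace ℝ (Fin d) × ℤ =>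
        h p.1 * logisticPosterior u a p.1 := (hh.comp measurable_fst).mul (hη.comp measurable_fst)
    rw [lintegral_representedPair hF, lintegral_representedPair hF']
    have hφm : Measurable φ := φ.measurable
    have he : Measurable fun z : EuclideanSpace ℝ (Fin d) =>
        ENNReal.ofReal (Real.exp (2 * inner ℝ u z)) := by fun_prop
    have hplus : ∀ g : EuclideanSpace ℝ (Fin d) → ℝ≥0∞, Measurable g →
        ∫⁻ x, g (φ x) ∂multivariateGaussian m S =
          ∫⁻ z, ENNReal.ofReal (Real.exp (2 * inner ℝ u z)) * g z
            ∂(multivariateGaussian (-m) S).map φ := fun g hg => by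
      rw [← lintegral_map hg hφm, multivariateGaussian_map_eq_withDensity hS hφ hu,
        lintegral_withDensity_eq_lintegral_mul _ he hg]
      rfl
    have hminus : ∀ g : EuclideanSpace ℝ (Fin d) → ℝ≥0∞, Measurable g →
        ∫⁻ x, g (φ x) ∂multivariateGaussian (-m) S =
          ∫⁻ z, g z ∂(multivariateGaussian (-m) S).map φ := fun g hg => by
      rw [← lintegral_map hg hφm]
    have hc : ∀ b : ℤ, Measurable fun z => h z * (if b = a then 1 else 0 : ℝ≥0∞) := fun b =>
      hh.mul measurable_const
    have hg : Measurable fun z => h z * logisticPosterior u a z := hh.mul hη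
    simp only
    rw [hplus _ (hc 1), hminus _ (hc (-1)), hplus _ hg, hminus _ hg, ← mul_add, ← mul_add,
      ← lintegral_add_left (f := fun z => ENNReal.ofReal (Real.exp (2 * inner ℝ u z)) *
        (h z * (if 1 = a then 1 else 0))) (he.mul (hc 1)),
      ← lintegral_add_left (f := fun z => ENNReal.ofReal (Real.exp (2 * inner ℝ u z)) *
        (h z * logisticPosterior u a z)) (he.mul hg)]
    congr 1
    refine lintegral_congr fun z => ?_
    -- With both classes written against the law of class `-1`, Bayes' rule becomes a pointwise
    -- identity between weights `exp (2⟪u, z⟫)` and `1`.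
    have key : ENNReal.ofReal (Real.exp (2 * inner ℝ u z)) * (if 1 = a then 1 else 0) +
        (if -1 = a then 1 else 0) =
        ENNReal.ofReal (Real.exp (2 * inner ℝ u z)) * logisticPosterior u a z +
          logisticPosterior u a z := by
      have hs := fun s => Real.sigmoid_nonneg s
      unfold logisticPosterior
      rcases eq_or_ne a 1 with rfl | h1
      · simp only [if_true]
        rw [← ENNReal.ofReal_mul (Real.exp_pos _).le, ← ENNReal.ofReal_add
          (mul_nonneg (Real.exp_pos _).le (hs _)) (hs _), sigmoid_mul_exp_add_sigmoid]
        simp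
      rcases eq_or_ne a (-1) with rfl | h2
      · simp only [if_true]
        rw [if_neg h1, ← ENNReal.ofReal_mul (Real.exp_pos _).le, ← ENNReal.ofReal_add
          (mul_nonneg (Real.exp_pos _).le (hs _)) (hs _), sigmoid_neg_mul_exp_add_sigmoid]
        simp
      · simp [h1, h2, h1.symm, h2.symm]
    calc _ = h z * (ENNReal.ofReal (Real.exp (2 * inner ℝ u z)) * (if 1 = a then 1 else 0) +
        (if -1 = a then 1 else 0)) := by ring
      _ = _ := by rw [key]; ring

/-- Only centres in the range of `φ` can be treated, as a singular `φ` leaves the rest of the space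
without mass; test points lie in that range almost surely. -/
lemma representedPair_ball_ne_zero (hS : S.PosDef) (x : EuclideanSpace ℝ (Fin d)) {δ : ℝ}
    (hδ : 0 < δ) : representedPair m S φ {p | dist p.1 (φ x) < δ} ≠ 0 := by
  have hs : MeasurableSet {p : EuclideanSpace ℝ (Fin d) × ℤ | dist p.1 (φ x) < δ} :=
    measurableSet_lt (by fun_prop) measurable_const
  have := isOpenPosMeasure_multivariateGaussian (m := m) hS
  have hopen : IsOpen {y | dist (φ y) (φ x) < δ} :=
    isOpen_lt (φ.continuous.dist continuous_const) continuous_const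
  have hpos := hopen.measure_pos (multivariateGaussian m S) ⟨x, by simpa using hδ⟩
  rw [← lintegral_indicator_one hs, lintegral_representedPair (measurable_one.indicator hs)]
  have he : (fun y => ({p : EuclideanSpace ℝ (Fin d) × ℤ | dist p.1 (φ x) < δ}.indicator
      (1 : EuclideanSpace ℝ (Fin d) × ℤ → ℝ≥0∞) (φ y, (1 : ℤ)))) =
      {y | dist (φ y) (φ x) < δ}.indicator 1 := by
    ext y
    simp [Set.indicator_apply]
  rw [he, lintegral_indicator_one hopen.measurableSet]
  simp [hpos.ne']

lemma ae_representedPair_mem_range :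
    ∀ᵐ p ∂representedPair m S φ, p.1 ∈ Set.range φ := by
  have hr : MeasurableSet {p : EuclideanSpace ℝ (Fin d) × ℤ | p.1 ∈ Set.range φ} := by
    have : IsClosed (Set.range φ) :=
      (LinearMap.range φ.toLinearMap).closed_of_finiteDimensional
    exact this.measurableSet.preimage measurable_fst
  rw [representedPair, ae_map_iff measurable_represent.aemeasurable hr]
  exact ae_of_all _ fun p => ⟨p.1, rfl⟩

lemma representedPair_fst_singleton (hφ : ∀ x y, inner ℝ (φ x) y = inner ℝ x (φ y))
    (hφ0 : φ ≠ 0) (q : EuclideanSpace ℝ (Fin d)) :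
    representedPair m 1 φ {p | p.1 = q} = 0 := by
  obtain ⟨t, ht⟩ : ∃ t, φ t ≠ 0 := by
    by_contra! h
    exact hφ0 (ContinuousLinearMap.ext h)
  have hs : MeasurableSet {p : EuclideanSpace ℝ (Fin d) × ℤ | p.1 = q} :=
    measurableSet_eq_fun measurable_fst measurable_const
  have hnull : ∀ m' : EuclideanSpace ℝ (Fin d), multivariateGaussian m' 1 {x | φ x = q} = 0 := by
    intro m'
    have hlaw := multivariateGaussian_map_inner (m := m')
      (Matrix.PosSemidef.one (n := Fin d) (R := ℝ)) (φ t)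
    have hv : (inner ℝ (φ t) (toEuclideanCLM (𝕜 := ℝ) (1 : Matrix (Fin d) (Fin d) ℝ)
        (φ t))).toNNReal ≠ 0 := by
      simp [ht]
    have := nullSingletonClass_gaussianReal (μ := inner ℝ (φ t) m') hv
    -- By symmetry of `φ`, the fibre lies in a level set of `⟪φ t, ·⟫`, whose law is a nondegenerate
    -- real Gaussian.
    refine measure_mono_null (t := (fun x => inner ℝ (φ t) x) ⁻¹' {inner ℝ t q}) ?_ ?_
    · intro x hx
      simp only [Set.mem_ofPred_eq] at hx
      simp [hφ, hx]
    · rw [← Measure.map_apply (by fun_prop) (measurableSet_singleton _), hlaw]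
      exact measure_singleton _
  have hm : MeasurableSet {x | φ x = q} := measurableSet_eq_fun φ.measurable measurable_const
  rw [← lintegral_indicator_one hs, lintegral_representedPair (measurable_one.indicator hs)]
  have he : ∀ b : ℤ, (fun y => ({p : EuclideanSpace ℝ (Fin d) × ℤ | p.1 = q}.indicator
      (1 : EuclideanSpace ℝ (Fin d) × ℤ → ℝ≥0∞) (φ y, b))) = {y | φ y = q}.indicator 1 := by
    intro b
    ext y
    simp [Set.indicator_apply]
  rw [he, he, lintegral_indicator_one hm, lintegral_indicator_one hm, hnull, hnull]
  simp

end LabelledLaw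

/-! ### From represented samples back to the original ones. -/

section Transfer

variable {d : ℕ}

lemma oneNNLabel_eq_nnLabel {n : ℕ} (R : Matrix (Fin d) (Fin d) ℝ) (D : LabelledSample d n)
    (x : EuclideanSpace ℝ (Fin d)) :
    oneNNLabel R D x = nnLabel (fun i => (toEuclideanCLM (𝕜 := ℝ) R (D i).1, (D i).2))
      (toEuclideanCLM (𝕜 := ℝ) R x) := by
  unfold oneNNLabel nnLabel nnIndex
  rfl

/-- If the labelling error in the represented space converges, the one of the representation
does. -/
lemma isAsymptoticOneNNError_of_representedPair {R : Matrix (Fin d) (Fin d) ℝ}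
    {μ m : EuclideanSpace ℝ (Fin d)} {S T : Matrix (Fin d) (Fin d) ℝ} {L : ℝ}
    (h1 : ∀ ε : ℝ, 0 < ε → Tendsto (fun n : ℕ =>
      Measure.pi (fun _ : Fin (n + 1) => representedPair μ S (toEuclideanCLM (𝕜 := ℝ) R))
      {D | ε ≤ |(representedPair m T (toEuclideanCLM (𝕜 := ℝ) R)).real
        {p | nnLabel D p.1 ≠ p.2} - L|}) atTop (𝓝 0))
    (h2 : Tendsto (fun n : ℕ =>
      ((Measure.pi (fun _ : Fin (n + 1) => representedPair μ S (toEuclideanCLM (𝕜 := ℝ) R))).prod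
        (representedPair m T (toEuclideanCLM (𝕜 := ℝ) R))).real
      {z | nnLabel z.1 z.2.1 ≠ z.2.2}) atTop (𝓝 L)) :
    IsAsymptoticOneNNError R μ S m T L := by
  set φ := toEuclideanCLM (𝕜 := ℝ) R with hφ
  have hrep := measurable_represent (φ := φ)
  have hpi : ∀ n : ℕ, Measure.pi (fun _ : Fin (n + 1) => representedPair μ S φ) =
      (sampleLaw μ S n).map fun D i => (φ (D i).1, (D i).2) := fun n =>
    (Measure.pi_map_pi fun _ => hrep.aemeasurable).symm
  have hpim : ∀ n : ℕ, Measurable fun (D : LabelledSample d n) i => (φ (D i).1, (D i).2) :=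
    fun n => measurable_pi_lambda _ fun i => hrep.comp (measurable_pi_apply i)
  have herr : ∀ (n : ℕ) (D : LabelledSample d n), oneNNError R m T D =
      (representedPair m T φ).real {p | nnLabel (fun i => (φ (D i).1, (D i).2)) p.1 ≠ p.2} := by
    intro n D
    have hms : MeasurableSet {p : EuclideanSpace ℝ (Fin d) × ℤ |
        nnLabel (fun i => (φ (D i).1, (D i).2)) p.1 ≠ p.2} :=
      (measurable_prodMk_left (x := fun i => (φ (D i).1, (D i).2))
        (measurableSet_nnLabel_eq n)).compl
    rw [representedPair, map_measureReal_apply hrep hms, oneNNError]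
    simp only [oneNNLabel_eq_nnLabel]
    rfl
  constructor
  · intro ε hε
    refine (h1 ε hε).congr fun n => ?_
    have hms : MeasurableSet {D : Fin (n + 1) → EuclideanSpace ℝ (Fin d) × ℤ |
        ε ≤ |(representedPair m T φ).real {p | nnLabel D p.1 ≠ p.2} - L|} := by
      have : Measurable fun D : Fin (n + 1) → EuclideanSpace ℝ (Fin d) × ℤ =>
          (representedPair m T φ).real {p | nnLabel D p.1 ≠ p.2} :=
        (measurable_measure_prodMk_left (measurableSet_nnLabel_eq n).compl).ennreal_toReal
      exact measurableSet_le measurable_const (this.sub_const L).abs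
    rw [hpi, Measure.map_apply (hpim n) hms]
    simp only [herr]
    rfl
  · refine h2.congr fun n => ?_
    have hprod : (Measure.pi (fun _ : Fin (n + 1) => representedPair μ S φ)).prod
        (representedPair m T φ) = ((sampleLaw μ S n).prod (balancedGaussianPair m T)).map
          (Prod.map (fun D i => (φ (D i).1, (D i).2)) fun p => (φ p.1, p.2)) := by
      have : SFinite (sampleLaw μ S n) := by unfold sampleLaw; infer_instance
      rw [hpi, representedPair, Measure.map_prod_map _ _ (hpim n) hrep]
    have hms : MeasurableSet {z : (Fin (n + 1) → EuclideanSpace ℝ (Fin d) × ℤ) ×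
        (EuclideanSpace ℝ (Fin d) × ℤ) | nnLabel z.1 z.2.1 ≠ z.2.2} :=
      (measurableSet_nnLabel_eq n).compl
    rw [hprod, map_measureReal_apply ((hpim n).prodMap hrep) hms]
    simp only [oneNNLabel_eq_nnLabel]
    rfl

end Transfer

/-! ### Gaussian averages of the logistic function. -/

section LogisticGaussian

open scoped NNReal

lemma continuous_sigmoid_two_mul : Continuous fun s : ℝ => Real.sigmoid (2 * s) :=
  continuous_sigmoid.comp (by fun_prop)

lemma integrable_sigmoid_comp {ρ : Measure ℝ} [IsFiniteMeasure ρ] {f : ℝ → ℝ}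
    (hf : Continuous f) : Integrable (fun s => Real.sigmoid (f s)) ρ := by
  refine Integrable.of_bound (continuous_sigmoid.comp hf).aestronglyMeasurable 1
    (ae_of_all _ fun s => ?_)
  rw [Real.norm_eq_abs, abs_of_nonneg (Real.sigmoid_nonneg _)]
  exact Real.sigmoid_le_one _

/-- Averaging the logistic function over a Gaussian and over its reflection at the mean. -/
lemma two_mul_integral_sigmoid_gaussianReal (a : ℝ) (v : ℝ≥0) :
    2 * ∫ s, Real.sigmoid (2 * s) ∂gaussianReal a v =
      1 + ∫ s, (Real.sigmoid (2 * s) - Real.sigmoid (2 * s - 4 * a)) ∂gaussianReal a v := by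
  have hrefl : ∫ s, Real.sigmoid (2 * s) ∂gaussianReal a v =
      ∫ s, (1 - Real.sigmoid (2 * s - 4 * a)) ∂gaussianReal a v := by
    -- The reflection `s ↦ 2 a - s` preserves the law, and `sigmoid (-x) = 1 - sigmoid x`. In the
    -- resulting difference the arguments are shifted by `4 a`, so monotonicity lets the sign of `a`
    -- decide.
    have hmap := gaussianReal_map_const_sub (μ := a) (v := v) (2 * a)
    rw [show 2 * a - a = a by ring] at hmap
    conv_lhs => rw [← hmap]
    rw [integral_map (by fun_prop) continuous_sigmoid_two_mul.aestronglyMeasurable]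
    refine integral_congr_ae (ae_of_all _ fun s => ?_)
    simp only
    rw [← Real.sigmoid_neg]
    ring_nf
  have h1 : Integrable (fun s => Real.sigmoid (2 * s)) (gaussianReal a v) :=
    integrable_sigmoid_comp (by fun_prop)
  have h2 : Integrable (fun s => Real.sigmoid (2 * s - 4 * a)) (gaussianReal a v) :=
    integrable_sigmoid_comp (by fun_prop)
  rw [integral_sub (integrable_const _) h2] at hrefl
  rw [integral_sub h1 h2, two_mul]
  simp only [integral_const, probReal_univ, smul_eq_mul, mul_one] at hrefl
  linarith

lemma one_half_le_integral_sigmoid_gaussianReal {a : ℝ} (ha : 0 ≤ a) (v : ℝ≥0) :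
    1 / 2 ≤ ∫ s, Real.sigmoid (2 * s) ∂gaussianReal a v := by
  have h := two_mul_integral_sigmoid_gaussianReal a v
  have : 0 ≤ ∫ s, (Real.sigmoid (2 * s) - Real.sigmoid (2 * s - 4 * a)) ∂gaussianReal a v :=
    integral_nonneg fun s => sub_nonneg.2 (Real.sigmoid_le (by linarith))
  linarith

/-- The symmetrised integrand is strictly negative at every point, so the inequality is strict even
for `v = 0`. -/
lemma integral_sigmoid_gaussianReal_lt_one_half {a : ℝ} (ha : a < 0) (v : ℝ≥0) :
    ∫ s, Real.sigmoid (2 * s) ∂gaussianReal a v < 1 / 2 := by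
  have h := two_mul_integral_sigmoid_gaussianReal a v
  have hpos : ∀ s, 0 < Real.sigmoid (2 * s - 4 * a) - Real.sigmoid (2 * s) := fun s =>
    sub_pos.2 (Real.sigmoid_lt (by linarith))
  have hint : 0 < ∫ s, (Real.sigmoid (2 * s - 4 * a) - Real.sigmoid (2 * s)) ∂gaussianReal a v := by
    rw [integral_pos_iff_support_of_nonneg (fun s => (hpos s).le)
      ((integrable_sigmoid_comp (by fun_prop)).sub (integrable_sigmoid_comp (by fun_prop)))]
    have : Function.support (fun s => Real.sigmoid (2 * s - 4 * a) - Real.sigmoid (2 * s)) =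
        Set.univ := Set.eq_univ_of_forall fun s => (hpos s).ne'
    rw [this]
    simp
  have hneg : ∫ s, (Real.sigmoid (2 * s) - Real.sigmoid (2 * s - 4 * a)) ∂gaussianReal a v =
      -∫ s, (Real.sigmoid (2 * s - 4 * a) - Real.sigmoid (2 * s)) ∂gaussianReal a v := by
    rw [← integral_neg]
    simp
  linarith

end LogisticGaussian

/-! ### The asymptotic error as a Gaussian integral, and the zero representation. -/

section AsymptoticError

variable {d : ℕ}

/-- The probability that a label drawn from the logistic posterior at a standard Gaussian test
point is correct, as a one-dimensional Gaussian integral. -/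
lemma toReal_lintegral_logisticPosterior {m u : EuclideanSpace ℝ (Fin d)}
    {φ : EuclideanSpace ℝ (Fin d) →L[ℝ] EuclideanSpace ℝ (Fin d)}
    (hφ : ∀ x y, inner ℝ (φ x) y = inner ℝ x (φ y)) :
    ∃ v, (∫⁻ p, logisticPosterior u p.2 p.1 ∂representedPair m 1 φ).toReal =
      ∫ s, Real.sigmoid (2 * s) ∂gaussianReal (inner ℝ (φ u) m) v := by
  have hlaw := fun m' : EuclideanSpace ℝ (Fin d) => multivariateGaussian_map_inner (m := m')
    (Matrix.PosSemidef.one (n := Fin d) (R := ℝ)) (φ u)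
  set v := (inner ℝ (φ u) (toEuclideanCLM (𝕜 := ℝ) (1 : Matrix (Fin d) (Fin d) ℝ)
    (φ u))).toNNReal
  refine ⟨v, ?_⟩
  have hmeas : Measurable fun s : ℝ => ENNReal.ofReal (Real.sigmoid (2 * s)) :=
    continuous_sigmoid_two_mul.measurable.ennreal_ofReal
  have hF : Measurable fun p : EuclideanSpace ℝ (Fin d) × ℤ => logisticPosterior u p.2 p.1 :=
    measurable_from_prod_countable_left fun a => (continuous_logisticPosterior u a).measurable
  have e1 : ∫⁻ x, logisticPosterior u 1 (φ x) ∂multivariateGaussian m 1 =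
      ∫⁻ s, ENNReal.ofReal (Real.sigmoid (2 * s)) ∂gaussianReal (inner ℝ (φ u) m) v := by
    rw [← hlaw m, lintegral_map hmeas (by fun_prop)]
    simp [logisticPosterior, hφ]
  -- Changing the sign of the label and of the mean together leaves the accuracy unchanged, so both
  -- classes contribute the same integral.
  have e2 : ∫⁻ x, logisticPosterior u (-1) (φ x) ∂multivariateGaussian (-m) 1 =
      ∫⁻ s, ENNReal.ofReal (Real.sigmoid (2 * s)) ∂gaussianReal (inner ℝ (φ u) m) v := by
    have hneg := gaussianReal_map_neg (μ := inner ℝ (φ u) (-m)) (v := v)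
    rw [inner_neg_right, neg_neg, ← inner_neg_right] at hneg
    rw [← hneg, lintegral_map hmeas measurable_neg, ← hlaw (-m),
      lintegral_map (f := fun s => ENNReal.ofReal (Real.sigmoid (2 * -s)))
        (hmeas.comp measurable_neg) (by fun_prop)]
    simp [logisticPosterior, hφ]
  rw [lintegral_representedPair hF]
  simp only
  rw [e1, e2, ← add_mul, ENNReal.add_halves, one_mul,
    integral_eq_lintegral_of_nonneg_ae (ae_of_all _ fun s => Real.sigmoid_nonneg _)
      continuous_sigmoid_two_mul.aestronglyMeasurable]

/-- The asymptotic nearest neighbour error for a non-zero symmetric representation. -/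
theorem exists_isAsymptoticOneNNError {μ m u : EuclideanSpace ℝ (Fin d)}
    {S R : Matrix (Fin d) (Fin d) ℝ} (hS : S.PosDef)
    (hR : ∀ x y, inner ℝ (toEuclideanCLM (𝕜 := ℝ) R x) y = inner ℝ x (toEuclideanCLM (𝕜 := ℝ) R y))
    (hR0 : toEuclideanCLM (𝕜 := ℝ) R ≠ 0)
    (hu : toEuclideanCLM (𝕜 := ℝ) R (toEuclideanCLM (𝕜 := ℝ) S (toEuclideanCLM (𝕜 := ℝ) R u)) =
      toEuclideanCLM (𝕜 := ℝ) R μ) :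
    ∃ v, IsAsymptoticOneNNError R μ S m 1
      (1 - ∫ s, Real.sigmoid (2 * s)
        ∂gaussianReal (inner ℝ (toEuclideanCLM (𝕜 := ℝ) R u) m) v) := by
  obtain ⟨v, hv⟩ := toReal_lintegral_logisticPosterior (m := m) (u := u) hR
  refine ⟨v, ?_⟩
  rw [← hv]
  have h := (isPosterior_representedPair hS.posSemidef hR hu).tendsto_nnLabel_error
    (T := representedPair m 1 (toEuclideanCLM (𝕜 := ℝ) R)) (continuous_logisticPosterior u) (by
      filter_upwards [ae_representedPair_mem_range] with p hp δ hδ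
      obtain ⟨x, hx⟩ := hp
      rw [← hx]
      exact representedPair_ball_ne_zero hS x hδ)
    (representedPair_fst_singleton hR hR0)
  exact isAsymptoticOneNNError_of_representedPair h.1 h.2

lemma balancedGaussianPair_real_label_ne {m : EuclideanSpace ℝ (Fin d)}
    {S : Matrix (Fin d) (Fin d) ℝ} {a : ℤ} (ha : a = 1 ∨ a = -1) :
    (balancedGaussianPair m S).real {p | a ≠ p.2} = 1 / 2 := by
  have hs : MeasurableSet {p : EuclideanSpace ℝ (Fin d) × ℤ | a ≠ p.2} :=
    (measurableSet_eq_fun measurable_const measurable_snd).compl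
  have : balancedGaussianPair m S {p | a ≠ p.2} = 1 / 2 := by
    rw [← lintegral_indicator_one hs,
      lintegral_balancedGaussianPair (measurable_one.indicator hs)]
    rcases ha with rfl | rfl <;> simp
  rw [Measure.real, this]
  simp

/-- If the representation is zero, all sample points are nearest neighbours, and the error is
one half. -/
lemma isAsymptoticOneNNError_of_eq_zero {μ m : EuclideanSpace ℝ (Fin d)}
    {S T R : Matrix (Fin d) (Fin d) ℝ} (hR : toEuclideanCLM (𝕜 := ℝ) R = 0) :
    IsAsymptoticOneNNError R μ S m T (1 / 2) := by
  have hlabel : ∀ (n : ℕ) (D : LabelledSample d n) (x : EuclideanSpace ℝ (Fin d)),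
      oneNNLabel R D x = (D 0).2 := by
    intro n D x
    have h0 : (nearestIndices R D x).min' (nearestIndices_nonempty R D x) = 0 :=
      le_antisymm (Finset.min'_le _ _ (by simp [nearestIndices, hR])) (Fin.zero_le _)
    rw [oneNNLabel, h0]
  -- A constant answer other than `1` or `-1` would almost surely be wrong, so the value one half
  -- needs this.
  have hae : ∀ᵐ p ∂balancedGaussianPair μ S, p.2 = 1 ∨ p.2 = -1 := by
    have hs : MeasurableSet {p : EuclideanSpace ℝ (Fin d) × ℤ | ¬ (p.2 = 1 ∨ p.2 = -1)} :=
      (measurable_snd (MeasurableSet.of_discrete (s := {b : ℤ | ¬ (b = 1 ∨ b = -1)})))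
    rw [ae_iff, ← lintegral_indicator_one hs,
      lintegral_balancedGaussianPair (measurable_one.indicator hs)]
    simp
  have hae' : ∀ n : ℕ, ∀ᵐ D ∂sampleLaw μ S n, (D 0).2 = 1 ∨ (D 0).2 = -1 := fun n =>
    (Measure.quasiMeasurePreserving_eval (fun _ : Fin (n + 1) => balancedGaussianPair μ S) 0).ae hae
  have herr : ∀ n : ℕ, ∀ᵐ D ∂sampleLaw μ S n, oneNNError R m T D = 1 / 2 := by
    intro n
    filter_upwards [hae' n] with D hD
    simp only [oneNNError, hlabel]
    exact balancedGaussianPair_real_label_ne hD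
  have hprob : ∀ n : ℕ, IsProbabilityMeasure (sampleLaw μ S n) := fun n => by
    unfold sampleLaw
    infer_instance
  constructor
  · intro ε hε
    refine tendsto_const_nhds.congr fun n => ?_
    have : sampleLaw μ S n {D | ¬ oneNNError R m T D = 1 / 2} = 0 := ae_iff.1 (herr n)
    refine (measure_mono_null (fun D hD hD' => ?_) this).symm
    simp only [Set.mem_ofPred_eq, hD', sub_self, abs_zero] at hD
    exact absurd hD (not_le.2 hε)
  · refine tendsto_const_nhds.congr fun n => ?_
    have hs : MeasurableSet {q : LabelledSample d n × (EuclideanSpace ℝ (Fin d) × ℤ) |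
        (q.1 0).2 ≠ q.2.2} :=
      (measurableSet_eq_fun (by fun_prop) (by fun_prop)).compl
    simp only [hlabel]
    rw [Measure.real, Measure.prod_apply hs]
    have hhalf : ∀ᵐ D ∂sampleLaw μ S n, balancedGaussianPair m T
        (Prod.mk D ⁻¹' {q : LabelledSample d n × (EuclideanSpace ℝ (Fin d) × ℤ) |
          (q.1 0).2 ≠ q.2.2}) = ENNReal.ofReal (1 / 2) := by
      filter_upwards [hae' n] with D hD
      have := balancedGaussianPair_real_label_ne (m := m) (S := T) hD
      rw [← this, ofReal_measureReal]
      rfl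
    rw [lintegral_congr_ae hhalf]
    simp

end AsymptoticError

/-! ### Comparison of the two errors. -/

theorem mainTheorem4 (d : ℕ) (μ μmin : EuclideanSpace ℝ (Fin d))
    (S : Matrix (Fin d) (Fin d) ℝ) (hS : S.PosDef)
    (hneg : μmin.ofLp ⬝ᵥ (S⁻¹ *ᵥ μ.ofLp) < 0) :
    μ - μmin ≠ 0 ∧
    ∃ P : Matrix (Fin d) (Fin d) ℝ,
      toEuclideanCLM (𝕜 := ℝ) P =
        (Submodule.span ℝ {(1 / 2 : ℝ) • (μ - μmin)})ᗮ.starProjection ∧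
      ∃ errRep errRaw : ℝ,
        IsAsymptoticOneNNError P μ S μmin 1 errRep ∧
        IsAsymptoticOneNNError 1 μ S μmin 1 errRaw ∧
        errRep < errRaw := by
  set A := toEuclideanCLM (𝕜 := ℝ) S with hA
  set B := toEuclideanCLM (𝕜 := ℝ) S⁻¹ with hB
  have hAB : ∀ x, A (B x) = x := fun x => by
    have h : A * B = 1 := by
      rw [hA, hB, ← map_mul, Matrix.mul_nonsing_inv _ hS.det_pos.ne'.isUnit, map_one]
    exact congrArg (fun f => f x) h
  have hinner : inner ℝ μmin (B μ) < 0 := by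
    rw [inner_toEuclideanCLM]
    exact hneg
  have hne : μ - μmin ≠ 0 := by
    intro h
    rw [← sub_eq_zero.1 h] at hinner
    exact absurd (inner_toEuclideanCLM_nonneg hS.inv.posSemidef μ) (not_le.2 hinner)
  refine ⟨hne, ?_⟩
  obtain ⟨vRaw, hRaw⟩ := exists_isAsymptoticOneNNError (μ := μ) (m := μmin) (u := B μ) (R := 1) hS
    (by simp) (by
      rw [map_one]
      intro h
      exact hne (by simpa using congrArg (fun f => f (μ - μmin)) h)) (by simpa using hAB μ)
  have hRawLt : (1 : ℝ) / 2 < 1 - ∫ s, Real.sigmoid (2 * s)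
      ∂gaussianReal (inner ℝ (toEuclideanCLM (𝕜 := ℝ) (1 : Matrix (Fin d) (Fin d) ℝ) (B μ)) μmin)
        vRaw := by
    have := integral_sigmoid_gaussianReal_lt_one_half
      (a := inner ℝ (toEuclideanCLM (𝕜 := ℝ) (1 : Matrix (Fin d) (Fin d) ℝ) (B μ)) μmin)
      (by rw [map_one, one_apply_eq_self, real_inner_comm]; exact hinner) vRaw
    linarith
  set w := (1 / 2 : ℝ) • (μ - μmin) with hw
  have hw0 : w ≠ 0 := smul_ne_zero (by norm_num) hne
  obtain ⟨P, hP⟩ : ∃ P : Matrix (Fin d) (Fin d) ℝ,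
      toEuclideanCLM (𝕜 := ℝ) P = (Submodule.span ℝ {w})ᗮ.starProjection :=
    ⟨(toEuclideanCLM (𝕜 := ℝ)).symm _, StarAlgEquiv.apply_symm_apply _ _⟩
  refine ⟨P, hP, ?_⟩
  -- The value `1/2` separates the two errors.
  suffices h : ∃ errRep, IsAsymptoticOneNNError P μ S μmin 1 errRep ∧ errRep ≤ 1 / 2 by
    obtain ⟨errRep, h1, h2⟩ := h
    exact ⟨errRep, _, h1, hRaw, h2.trans_lt hRawLt⟩
  -- This happens for `d = 1`, where `w` spans the whole space and represented test points all
  -- coincide.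
  by_cases hP0 : toEuclideanCLM (𝕜 := ℝ) P = 0
  · exact ⟨1 / 2, isAsymptoticOneNNError_of_eq_zero hP0, le_rfl⟩
  have hBw : inner ℝ w (B w) ≠ 0 := by
    rw [inner_toEuclideanCLM]
    have := hS.inv.dotProduct_mulVec_pos (x := w.ofLp) (by simpa using hw0)
    simpa using this.ne'
  -- The value of `c` that makes `u` orthogonal to `w`; then `P u = u`, and `P (A u) = P μ` because
  -- `P w = 0`.
  set c := inner ℝ w (B μ) / inner ℝ w (B w) with hc
  set u := B (μ - c • w) with hu
  have hAu : A u = μ - c • w := hAB _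
  have hwu : inner ℝ w u = 0 := by
    rw [hu, map_sub, map_smul, inner_sub_right, real_inner_smul_right, hc,
      div_mul_cancel₀ _ hBw, sub_self]
  have hPu : toEuclideanCLM (𝕜 := ℝ) P u = u := by
    rw [hP, Submodule.starProjection_eq_self_iff, Submodule.mem_orthogonal_singleton_iff_inner_right]
    exact hwu
  have hPw : toEuclideanCLM (𝕜 := ℝ) P w = 0 := by
    rw [hP, Submodule.starProjection_apply_eq_zero_iff, Submodule.orthogonal_orthogonal]
    exact Submodule.mem_span_singleton_self w
  obtain ⟨v, hRep⟩ := exists_isAsymptoticOneNNError (μ := μ) (m := μmin) (u := u) (R := P) hS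
    (fun x y => by rw [hP]; exact Submodule.inner_starProjection_left_eq_right _ x y) hP0
    (by rw [hPu, ← hA, hAu, map_sub, map_smul, hPw, smul_zero, sub_zero])
  refine ⟨_, hRep, ?_⟩
  -- From `μ = A u + c w` and `μmin = μ - 2 w`; the `w` term is invisible to `u`.
  have hmin : μmin = A u + (c - 2) • w := by
    rw [hAu, hw]
    module
  have hnonneg : 0 ≤ inner ℝ (toEuclideanCLM (𝕜 := ℝ) P u) μmin := by
    rw [hPu, hmin, inner_add_right, real_inner_smul_right, real_inner_comm w u, hwu, mul_zero,
      add_zero]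
    exact inner_toEuclideanCLM_nonneg hS.posSemidef u
  have := one_half_le_integral_sigmoid_gaussianReal hnonneg v
  linarith
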